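/- Let $d \in \mathbb{N}$, $d\ge 1$, $1 \le p \le u < \infty$, $1 \le q \le \infty$ and $s\in\mathbb{R}$, and suppose that $s \ge 1 + 1/p$ or $s > 1 + d/u$. Let $\varphi_0 \in C_0^\infty(\mathbb{R}^d)$ denote a non-negative function with $\varphi_0(x)=1$ for $|x|\le 1$ and $\varphi_0(x)=0$ for $|x|\ge 3/2$, and put $\varphi_k(x)=\varphi_0(2^{-k}x)-\varphi_0(2^{-k+1}x)$ for $k\ge 1$. The real Triebel-Lizorkin-Morrey space $\mathbb{E}^s_{u,p,q}(\mathbb{R}^d)$ is the set of all real-valued $f\in L_1^{loc}(\mathbb{R}^d)\cap\mathcal{S}'(\mathbb{R}^d)$ with $$\Big\| \Big(\sum_{k=0}^\infty 2^{ksq}\,\big|\mathcal{F}^{-1}[\varphi_k\mathcal{F}f](\cdot)\big|^q\Big)^{1/q} \Big| \mathcal{M}^u_p(\mathbb{R}^d)\Big\| < \infty, \qquad \|g|\mathcal{M}^u_p(\mathbb{R}^d)\| = \sup_{y\in\mathbb{R}^d,\, r>0} |B(y,r)|^{\frac1u-\frac1p}\Big(\int_{B(y,r)}|g(x)|^p\,dx\Big)^{1/p}$$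 (with a supremum over $k$ in place of the sum if $q=\infty$). Then there exists a real-valued function $f\in C_0^\infty(\mathbb{R}^d)$ with $f(x)=x_1$ for all $x$ in a neighbourhood of the origin such that, for every choice of $\varphi_0$ as above, $$f\in\mathbb{E}^s_{u,p,q}(\mathbb{R}^d),\qquad |f|\notin\mathbb{E}^s_{u,p,q}(\mathbb{R}^d),\qquad \max(f,0)\notin\mathbb{E}^s_{u,p,q}(\mathbb{R}^d).$$ -/

import Mathlib

open MeasureTheory SchwartzMap
open scoped ENNReal ContDiff Topology

namespace MorreyTruncation

noncomputable section

/-- `φ₀` generates a smooth dyadic decomposition of unity on `ℝ^d`: it is smooth, nonnegative,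
equal to `1` on the closed unit ball, and `0` where `|x| ≥ 3/2`. -/
structure IsDyadicGenerator {d : ℕ} (φ₀ : EuclideanSpace ℝ (Fin d) → ℝ) : Prop where
  contDiff : ContDiff ℝ ∞ φ₀
  nonneg : ∀ x, 0 ≤ φ₀ x
  eq_one : ∀ x, ‖x‖ ≤ 1 → φ₀ x = 1
  eq_zero : ∀ x, 3 / 2 ≤ ‖x‖ → φ₀ x = 0

/-- The `k`-th member of the dyadic decomposition generated by `φ₀`: `φ₀` itself for `k = 0`, and
`x ↦ φ₀ (2^{-k} x) - φ₀ (2^{-k+1} x)` for `k ≥ 1`. -/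
def dyadicPiece {d : ℕ} (φ₀ : EuclideanSpace ℝ (Fin d) → ℝ) (k : ℕ)
    (x : EuclideanSpace ℝ (Fin d)) : ℝ :=
  if k = 0 then φ₀ x
  else φ₀ ((2 : ℝ) ^ (-(k : ℤ)) • x) - φ₀ ((2 : ℝ) ^ (-(k : ℤ) + 1) • x)

/-- The Morrey norm
`sup_{y ∈ ℝ^d, r > 0} |B(y,r)|^{1/u - 1/p} (∫_{B(y,r)} g^p dx)^{1/p}`
of a `[0,∞]`-valued function `g` (to be applied to absolute values). -/
def morreyNorm {d : ℕ} (u p : ℝ) (g : EuclideanSpace ℝ (Fin d) → ℝ≥0∞) : ℝ≥0∞ :=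
  ⨆ (y : EuclideanSpace ℝ (Fin d)) (r : ℝ) (_ : 0 < r),
    volume (Metric.ball y r) ^ (1 / u - 1 / p) *
      (∫⁻ x in Metric.ball y r, g x ^ p) ^ (1 / p)

/-- The weighted sequence norm `(∑_k 2^{ksq} a_k^q)^{1/q}`, with `sup_k 2^{ks} a_k` for
`q = ∞`. -/
def weightedSeqNorm (s : ℝ) (q : ℝ≥0∞) (a : ℕ → ℝ≥0∞) : ℝ≥0∞ :=
  if q = ⊤ then ⨆ k : ℕ, (2 : ℝ≥0∞) ^ ((k : ℝ) * s) * a k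
  else (∑' k : ℕ, (2 : ℝ≥0∞) ^ ((k : ℝ) * s * q.toReal) * a k ^ q.toReal) ^ (1 / q.toReal)

/-- The tempered distribution `T` is the one given by the real function `f`: the function is
locally integrable and `T` acts on compactly supported test functions by integration against
`f`. (Such test functions are dense in the Schwartz space, so `f` determines `T`.) -/
def IsRegularDistribution {d : ℕ} (f : EuclideanSpace ℝ (Fin d) → ℝ)
    (T : 𝓢'(EuclideanSpace ℝ (Fin d), ℂ)) : Prop :=
  LocallyIntegrable f volume ∧
    ∀ ψ : 𝓢(EuclideanSpace ℝ (Fin d), ℂ), HasCompactSupport ψ →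
      T ψ = ∫ x, ψ x * (f x : ℂ)

/-- The smooth function `g` (with polynomially bounded derivatives) represents the tempered
distribution `𝓕⁻¹[φ 𝓕 T]`. -/
def RepresentsMultiplier {d : ℕ} (φ : EuclideanSpace ℝ (Fin d) → ℝ)
    (T : 𝓢'(EuclideanSpace ℝ (Fin d), ℂ)) (g : EuclideanSpace ℝ (Fin d) → ℂ) : Prop :=
  ∃ hg : g.HasTemperateGrowth,
    hg.toTemperedDistribution volume =
      TemperedDistribution.fourierMultiplierCLM ℂ (fun ξ => (φ ξ : ℂ)) T

/-- The real Triebel–Lizorkin–Morrey space `𝔼^s_{u,p,q}(ℝ^d)`, defined through the dyadic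
decomposition generated by `φ₀`: the real-valued `f ∈ L₁^{loc} ∩ 𝓢'` for which
`‖(∑_k 2^{ksq} |𝓕⁻¹[φ_k 𝓕 f](x)|^q)^{1/q}‖` in the Morrey norm is finite. Here `g k` is the
smooth function `𝓕⁻¹[φ_k 𝓕 f]`. -/
def triebelLizorkinMorrey {d : ℕ} (φ₀ : EuclideanSpace ℝ (Fin d) → ℝ) (s u p : ℝ) (q : ℝ≥0∞) :
    Set (EuclideanSpace ℝ (Fin d) → ℝ) :=
  {f | ∃ (T : 𝓢'(EuclideanSpace ℝ (Fin d), ℂ)) (g : ℕ → EuclideanSpace ℝ (Fin d) → ℂ),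
    IsRegularDistribution f T ∧
    (∀ k, RepresentsMultiplier (dyadicPiece φ₀ k) T (g k)) ∧
    morreyNorm u p (fun x => weightedSeqNorm s q (fun k => ‖g k x‖ₑ)) < ⊤}

end

end MorreyTruncation

namespace MorreyTruncation

noncomputable section

open FourierTransform

/-! ### Multipliers with bounded derivatives in the Schwartz seminorms -/

section SchwartzMultipliers

variable {E : Type*} [NormedAddCommGroup E] [NormedSpace ℝ E]

/-! Take `f = x₁ · b` with a smooth bump `b`. The Littlewood–Paley pieces of a test function decay
faster than any power of `2⁻ᵏ` and of `1 + ‖x‖`, so `f` lies in the space whatever `s` is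
(`mem_triebelLizorkinMorrey_of_contDiff`).

Near the origin `|f|` and `max(f, 0)` have the form `α|x₁| + βx₁` with `α ≠ 0`. Put `K = 𝓕⁻¹φ₁`. The
piece of index `k + 1` is `∫ K(t) h(x - 2⁻ᵏt) dt`, and since the kink is homogeneous of degree one
this equals `2⁻ᵏ P(2ᵏx₁) + O(4⁻ᵏ)`, uniformly for `x` in a small ball with `2ᵏ|x₁|` bounded, for a
fixed continuous profile `P`. Second differences of `P` are `α` times convolutions of `K` with a hat
function; their Fourier transform is a nonzero factor times `φ₁` on the first axis, and `φ₁ = 1` at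
distance `3/2`. So `P ≠ 0`, and the piece is at least `c 2⁻ᵏ` where `|2ᵏx₁ - t| < ρ`
(`exists_le_norm_integral`).

Each weighted piece is bounded by the sequence norm, so `q` plays no role: that norm is at least a
multiple of `2^(k(s-1))` on these slabs. For `s ≥ 1 + 1/p`, disjoint slabs of measure comparable to
`2⁻ᵏ` inside one ball each contribute at least a fixed amount to the `p`-th power integral. For `s >
1 + d/u`, balls of radius `2⁻ᵏρ` give Morrey quotients growing like `2^(k(s-1-d/u))`. Either way the
norm is infinite. -/

lemma norm_iteratedFDeriv_comp_smul_le {F : Type*} [NormedAddCommGroup F] [NormedSpace ℝ F]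
    {φ : E → F} (hφ : ContDiff ℝ ∞ φ) {n i : ℕ} (hi : i ≤ n) {C : ℝ}
    (hC : ∀ i ≤ n, ∀ x, ‖iteratedFDeriv ℝ i φ x‖ ≤ C) {c : ℝ} (hc : |c| ≤ 1) (x : E) :
    ‖iteratedFDeriv ℝ i (fun y => φ (c • y)) x‖ ≤ C := by
  rw [iteratedFDeriv_comp_const_smul (i := i) c (hφ.of_le (mod_cast le_top))]
  simp only [norm_smul, norm_pow, Real.norm_eq_abs]
  refine le_trans ?_ (hC i hi (c • x))
  exact mul_le_of_le_one_left (norm_nonneg _) (pow_le_one₀ (abs_nonneg _) hc)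

/-- If the multiplier `m` has bounded derivatives and vanishes on the ball of radius `R`, then
multiplication by `m` gains arbitrary powers of `R⁻¹` in the Schwartz seminorms. -/
lemma seminorm_smulLeftCLM_le {m : E → ℂ} (hm : m.HasTemperateGrowth) {n : ℕ} {C : ℝ}
    (hC : ∀ i ≤ n, ∀ x, ‖iteratedFDeriv ℝ i m x‖ ≤ C) {R : ℝ} (hR : 0 < R)
    (hmR : ∀ x, ‖x‖ < R → m x = 0) (ψ : 𝓢(E, ℂ)) (k N : ℕ) :
    SchwartzMap.seminorm ℂ k n (smulLeftCLM ℂ m ψ) ≤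
      (2 ^ n * C * ∑ j ∈ Finset.range (n + 1), SchwartzMap.seminorm ℂ (k + N) j ψ) / R ^ N := by
  have hC0 : 0 ≤ C := (norm_nonneg _).trans (hC 0 (Nat.zero_le _) 0)
  set S := ∑ j ∈ Finset.range (n + 1), SchwartzMap.seminorm ℂ (k + N) j ψ with hS
  have hS0 : 0 ≤ S := Finset.sum_nonneg fun j _ => apply_nonneg _ _
  refine SchwartzMap.seminorm_le_bound ℂ k n _ (by positivity) fun x => ?_
  have hfun : (smulLeftCLM ℂ m ψ : E → ℂ) = fun y => m y • ψ y := by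
    ext y; exact smulLeftCLM_apply_apply hm ψ y
  rw [hfun]
  -- Inside the ball `m` vanishes near `x`, so the derivative is zero; outside, `R ^ N ≤ ‖x‖ ^ N` is
  -- absorbed into a seminorm of higher weight.
  rcases lt_or_ge ‖x‖ R with hx | hx
  · have : (fun y => m y • ψ y) =ᶠ[𝓝 x] fun _ => 0 := by
      filter_upwards [(isOpen_lt continuous_norm continuous_const).mem_nhds hx] with y hy
      simp [hmR y hy]
    rw [this.iteratedFDeriv ℝ n |>.eq_of_nhds]
    have : iteratedFDeriv ℝ n (fun _ : E => (0 : ℂ)) x = 0 := by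
      simp
    rw [this]; simp only [norm_zero, mul_zero]; positivity
  · rw [le_div_iff₀ (by positivity)]
    have h1 := norm_iteratedFDeriv_smul_le (N := ∞) hm.1 ψ.smooth' x (n := n) (mod_cast le_top)
    have h2 : ∀ i ∈ Finset.range (n + 1), (n.choose i : ℝ) * ‖iteratedFDeriv ℝ i m x‖ *
        ‖iteratedFDeriv ℝ (n - i) ψ x‖ * ‖x‖ ^ (k + N) ≤ (n.choose i : ℝ) * C * S := by
      intro i hi
      rw [mul_assoc, mul_assoc, mul_assoc]
      refine mul_le_mul_of_nonneg_left ?_ (Nat.cast_nonneg _)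
      refine mul_le_mul (hC i (by grind) x) ?_ (by positivity) hC0
      rw [mul_comm]
      refine (SchwartzMap.le_seminorm ℂ (k + N) (n - i) ψ x).trans ?_
      exact Finset.single_le_sum (f := fun j => SchwartzMap.seminorm ℂ (k + N) j ψ)
        (fun j _ => apply_nonneg _ _) (by grind : n - i ∈ Finset.range (n + 1))
    calc ‖x‖ ^ k * ‖iteratedFDeriv ℝ n (fun y => m y • ψ y) x‖ * R ^ N
        ≤ ‖x‖ ^ k * ‖iteratedFDeriv ℝ n (fun y => m y • ψ y) x‖ * ‖x‖ ^ N := by gcongr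
      _ = ‖iteratedFDeriv ℝ n (fun y => m y • ψ y) x‖ * ‖x‖ ^ (k + N) := by ring
      _ ≤ (∑ i ∈ Finset.range (n + 1), (n.choose i : ℝ) * ‖iteratedFDeriv ℝ i m x‖ *
        ‖iteratedFDeriv ℝ (n - i) ψ x‖) * ‖x‖ ^ (k + N) := by gcongr; exact h1
      _ ≤ ∑ i ∈ Finset.range (n + 1), (n.choose i : ℝ) * C * S := by
          rw [Finset.sum_mul]; exact Finset.sum_le_sum h2
      _ = 2 ^ n * C * S := by
          rw [← Finset.sum_mul, ← Finset.sum_mul]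
          congr 2
          exact_mod_cast Nat.sum_range_choose n

lemma exists_bound_iteratedFDeriv {F : Type*} [NormedAddCommGroup F] [NormedSpace ℝ F]
    {φ : E → F} (hφ : ContDiff ℝ ∞ φ) (hc : HasCompactSupport φ) (n : ℕ) :
    ∃ C, ∀ i ≤ n, ∀ x, ‖iteratedFDeriv ℝ i φ x‖ ≤ C := by
  let φS : 𝓢(E, F) := hc.toSchwartzMap hφ
  refine ⟨∑ j ∈ Finset.range (n + 1), SchwartzMap.seminorm ℝ 0 j φS, fun i hi x => ?_⟩
  refine (SchwartzMap.norm_iteratedFDeriv_le_seminorm ℝ φS i x).trans ?_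
  exact Finset.single_le_sum (f := fun j => SchwartzMap.seminorm ℝ 0 j φS)
    (fun j _ => apply_nonneg _ _) (by grind : i ∈ Finset.range (n + 1))

lemma _root_.ContDiff.complex_ofReal {φ : E → ℝ} (hφ : ContDiff ℝ ∞ φ) :
    ContDiff ℝ ∞ fun x => (φ x : ℂ) :=
  Complex.ofRealCLM.contDiff.comp hφ

end SchwartzMultipliers

/-! ### Density of compactly supported functions in the Schwartz space -/

section Density

variable {E : Type*} [NormedAddCommGroup E] [InnerProductSpace ℝ E] [FiniteDimensional ℝ E]

/-- Every Schwartz function is the limit, in the Schwartz space, of compactly supported ones. -/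
lemma exists_seq_hasCompactSupport_tendsto (ψ : 𝓢(E, ℂ)) :
    ∃ u : ℕ → 𝓢(E, ℂ), (∀ j, HasCompactSupport (u j)) ∧
      Filter.Tendsto u Filter.atTop (𝓝 ψ) := by
  let b : ContDiffBump (0 : E) := ⟨1, 2, by norm_num, by norm_num⟩
  have hb : ContDiff ℝ ∞ fun x => (b x : ℂ) := b.contDiff.complex_ofReal
  have hbc : HasCompactSupport fun x => (b x : ℂ) :=
    b.hasCompactSupport.comp_left (g := fun r : ℝ => (r : ℂ)) Complex.ofReal_zero
  let c : ℕ → ℝ := fun j => ((j : ℝ) + 1)⁻¹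
  have hc0 : ∀ j, 0 < c j := fun j => by positivity
  have hc1 : ∀ j, |c j| ≤ 1 := fun j => by
    rw [abs_of_pos (hc0 j)]
    exact inv_le_one_of_one_le₀ (by simp)
  let m : ℕ → E → ℂ := fun j x => (b (c j • x) : ℂ)
  have hms : ∀ j, ContDiff ℝ ∞ (m j) := fun j => hb.comp (contDiff_const_smul (c j))
  have hmc : ∀ j, HasCompactSupport (m j) := fun j => by
    exact hbc.comp_homeomorph (Homeomorph.smulOfNeZero (c j) (hc0 j).ne')
  have hmt : ∀ j, (m j).HasTemperateGrowth := fun j => (hmc j).hasTemperateGrowth (hms j)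
  refine ⟨fun j => smulLeftCLM ℂ (m j) ψ, fun j => ?_, ?_⟩
  · have : (smulLeftCLM ℂ (m j) ψ : E → ℂ) = fun y => m j y • ψ y := by
      ext y; exact smulLeftCLM_apply_apply (hmt j) ψ y
    rw [this]
    exact (hmc j).smul_right
  · rw [(schwartz_withSeminorms ℂ E ℂ).tendsto_nhds _ ψ]
    rintro ⟨k, n⟩ ε hε
    simp only [schwartzSeminormFamily_apply]
    -- The error multiplier vanishes on the ball of radius `(c j)⁻¹` and has derivatives bounded
    -- uniformly in `j`, so one extra power of weight yields the factor `c j → 0`.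
    let η : ℕ → E → ℂ := fun j x => 1 - m j x
    have hη : ∀ j, (η j).HasTemperateGrowth := fun j =>
      (Function.HasTemperateGrowth.const 1).sub (hmt j)
    have hη' : ContDiff ℝ ∞ fun x => 1 - (b x : ℂ) := contDiff_const.sub hb
    obtain ⟨C₀, hC₀⟩ := exists_bound_iteratedFDeriv hb hbc n
    have hC : ∀ i ≤ n, ∀ x, ‖iteratedFDeriv ℝ i (fun x => 1 - (b x : ℂ)) x‖ ≤ 1 + C₀ := by
      intro i hi x
      have h1 : ‖iteratedFDeriv ℝ i (fun _ : E => (1 : ℂ)) x‖ ≤ 1 := by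
        rcases Nat.eq_zero_or_pos i with rfl | h
        · simp
        · rw [iteratedFDeriv_const_of_ne h.ne']; simp
      have h2 : iteratedFDeriv ℝ i (fun x => 1 - (b x : ℂ)) x =
          iteratedFDeriv ℝ i (fun _ : E => (1 : ℂ)) x -
            iteratedFDeriv ℝ i (fun x => (b x : ℂ)) x := by
        exact iteratedFDeriv_sub_apply contDiff_const.contDiffAt
          (hb.of_le (mod_cast le_top)).contDiffAt
      rw [h2]
      exact (norm_sub_le _ _).trans (add_le_add h1 (hC₀ i hi x))
    set S := 2 ^ n * (1 + C₀) *
      ∑ j ∈ Finset.range (n + 1), SchwartzMap.seminorm ℂ (k + 1) j ψ with hSdef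
    have key : ∀ j, SchwartzMap.seminorm ℂ k n (smulLeftCLM ℂ (m j) ψ - ψ) ≤ S * c j := by
      intro j
      have h1 : smulLeftCLM ℂ (m j) ψ - ψ = - smulLeftCLM ℂ (η j) ψ := by
        ext x
        simp only [sub_apply, neg_apply,
          smulLeftCLM_apply_apply (hmt j), smulLeftCLM_apply_apply (hη j), η, smul_eq_mul]
        ring
      rw [h1, map_neg_eq_map]
      have := seminorm_smulLeftCLM_le (hη j) (n := n) (C := 1 + C₀) (R := (c j)⁻¹)
        (fun i hi x => norm_iteratedFDeriv_comp_smul_le hη' hi hC (hc1 j) x)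
        (inv_pos.2 (hc0 j)) (fun x hx => ?_) ψ k 1
      · rw [pow_one, div_inv_eq_mul] at this
        exact this
      · have hle : ‖c j • x‖ ≤ 1 := by
          rw [norm_smul, Real.norm_of_nonneg (hc0 j).le]
          have := mul_lt_mul_of_pos_left hx (hc0 j)
          rw [mul_inv_cancel₀ (hc0 j).ne'] at this
          exact this.le
        have : b (c j • x) = 1 := b.one_of_mem_closedBall (by simpa using hle)
        simp [η, m, this]
    have hlim : Filter.Tendsto (fun j => S * c j) Filter.atTop (𝓝 0) := by
      have : Filter.Tendsto c Filter.atTop (𝓝 0) := by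
        simpa [c, one_div] using tendsto_one_div_add_atTop_nhds_zero_nat (𝕜 := ℝ)
      simpa using this.const_mul S
    filter_upwards [hlim.eventually (gt_mem_nhds hε)] with j hj
    exact (key j).trans_lt hj

/-- Two tempered distributions that agree on compactly supported Schwartz functions are equal. -/
lemma temperedDistribution_ext_of_hasCompactSupport {T T' : 𝓢'(E, ℂ)}
    (h : ∀ ψ : 𝓢(E, ℂ), HasCompactSupport ψ → T ψ = T' ψ) (ψ : 𝓢(E, ℂ)) : T ψ = T' ψ := by
  obtain ⟨u, hu, hlim⟩ := exists_seq_hasCompactSupport_tendsto ψ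
  have h1 := (T.continuous.tendsto ψ).comp hlim
  have h2 := (T'.continuous.tendsto ψ).comp hlim
  refine tendsto_nhds_unique h1 (h2.congr fun j => (h _ (hu j)).symm)

end Density

/-! ### Dyadic decomposition and rapid decay of Littlewood–Paley pieces -/

section DyadicPieces

variable {d : ℕ} {φ₀ : EuclideanSpace ℝ (Fin d) → ℝ}

lemma IsDyadicGenerator.hasCompactSupport (hφ : IsDyadicGenerator φ₀) : HasCompactSupport φ₀ := by
  refine HasCompactSupport.intro (isCompact_closedBall 0 (3 / 2)) fun x hx => hφ.eq_zero x ?_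
  simp only [Metric.mem_closedBall, dist_zero_right, not_le] at hx
  exact hx.le

lemma dyadicPiece_zero : dyadicPiece φ₀ 0 = φ₀ := by
  ext x; simp [dyadicPiece]

/-- All pieces of positive index are dilates of one function, so derivative bounds are uniform in
`k` and a single kernel serves every scale. -/
lemma dyadicPiece_succ (k : ℕ) (x : EuclideanSpace ℝ (Fin d)) :
    dyadicPiece φ₀ (k + 1) x = dyadicPiece φ₀ 1 (((2 : ℝ) ^ k)⁻¹ • x) := by
  simp only [dyadicPiece, Nat.succ_ne_zero, if_false, one_ne_zero, smul_smul]
  congr 3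
  · simp only [zpow_neg, Nat.cast_add, Nat.cast_one, zpow_one]
    rw [zpow_add₀ (by norm_num), zpow_natCast, zpow_one, mul_inv, mul_comm]
  · simp

lemma IsDyadicGenerator.dyadicPiece_one_eq_zero (hφ : IsDyadicGenerator φ₀)
    {x : EuclideanSpace ℝ (Fin d)} (hx : ‖x‖ ≤ 1) : dyadicPiece φ₀ 1 x = 0 := by
  simp only [dyadicPiece, one_ne_zero, if_false]
  rw [hφ.eq_one, hφ.eq_one, sub_self]
  · simpa using hx
  · rw [norm_smul]
    norm_num
    linarith [norm_nonneg x]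

lemma IsDyadicGenerator.contDiff_dyadicPiece (hφ : IsDyadicGenerator φ₀) (k : ℕ) :
    ContDiff ℝ ∞ (dyadicPiece φ₀ k) := by
  have h := hφ.contDiff
  cases k with
  | zero => rwa [dyadicPiece_zero]
  | succ k =>
    have : dyadicPiece φ₀ (k + 1) = fun x => φ₀ ((2 : ℝ) ^ (-((k + 1 : ℕ) : ℤ)) • x) -
        φ₀ ((2 : ℝ) ^ (-((k + 1 : ℕ) : ℤ) + 1) • x) := by
      funext x
      simp [dyadicPiece]
    rw [this]
    exact (h.comp (contDiff_const_smul _)).sub (h.comp (contDiff_const_smul _))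

lemma IsDyadicGenerator.hasCompactSupport_dyadicPiece (hφ : IsDyadicGenerator φ₀) (k : ℕ) :
    HasCompactSupport (dyadicPiece φ₀ k) := by
  have h := hφ.hasCompactSupport
  cases k with
  | zero => rwa [dyadicPiece_zero]
  | succ k =>
    have h1 : ∀ c : ℝ, c ≠ 0 → HasCompactSupport fun x => φ₀ (c • x) := fun c hc =>
      h.comp_homeomorph (Homeomorph.smulOfNeZero c hc)
    have h2 := (h1 ((2 : ℝ) ^ (-((k + 1 : ℕ) : ℤ))) (by positivity)).sub
      (h1 ((2 : ℝ) ^ (-((k + 1 : ℕ) : ℤ) + 1)) (by positivity))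
    have h3 : dyadicPiece φ₀ (k + 1) = (fun x => φ₀ ((2 : ℝ) ^ (-((k + 1 : ℕ) : ℤ)) • x)) -
        fun x => φ₀ ((2 : ℝ) ^ (-((k + 1 : ℕ) : ℤ) + 1) • x) := by
      funext x
      simp [dyadicPiece]
    rw [h3]
    exact h2

lemma IsDyadicGenerator.contDiff_complex (hφ : IsDyadicGenerator φ₀) (k : ℕ) :
    ContDiff ℝ ∞ fun x => (dyadicPiece φ₀ k x : ℂ) :=
  (hφ.contDiff_dyadicPiece k).complex_ofReal

lemma IsDyadicGenerator.hasCompactSupport_complex (hφ : IsDyadicGenerator φ₀) (k : ℕ) :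
    HasCompactSupport fun x => (dyadicPiece φ₀ k x : ℂ) :=
  (hφ.hasCompactSupport_dyadicPiece k).comp_left (g := fun r : ℝ => (r : ℂ)) Complex.ofReal_zero

lemma IsDyadicGenerator.hasTemperateGrowth (hφ : IsDyadicGenerator φ₀) (k : ℕ) :
    (fun x => (dyadicPiece φ₀ k x : ℂ)).HasTemperateGrowth :=
  (hφ.hasCompactSupport_complex k).hasTemperateGrowth (hφ.contDiff_complex k)

/-- The piece of index `k + 1` vanishes for `‖x‖ ≤ 2 ^ k`, and dilating by `2⁻ᵏ ≤ 1` does not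
increase derivatives; `seminorm_smulLeftCLM_le` then gains `(2 ^ k) ^ (-N)`. -/
lemma IsDyadicGenerator.exists_seminorm_mul_le (hφ : IsDyadicGenerator φ₀)
    (ψ : 𝓢(EuclideanSpace ℝ (Fin d), ℂ)) (N a b : ℕ) :
    ∃ C, ∀ k : ℕ, SchwartzMap.seminorm ℂ a b
      (smulLeftCLM ℂ (fun x => (dyadicPiece φ₀ k x : ℂ)) ψ) * (2 ^ k) ^ N ≤ C := by
  obtain ⟨C₀, hC₀⟩ := exists_bound_iteratedFDeriv (hφ.contDiff_complex 1)
    (hφ.hasCompactSupport_complex 1) b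
  set D := 2 ^ b * C₀ * ∑ j ∈ Finset.range (b + 1), SchwartzMap.seminorm ℂ (a + N) j ψ
  -- The index `0` is treated separately, and `2 ^ N` pays for the shift between `2 ^ (k + 1)` and
  -- the vanishing radius `2 ^ k`.
  refine ⟨max (SchwartzMap.seminorm ℂ a b
      (smulLeftCLM ℂ (fun x => (dyadicPiece φ₀ 0 x : ℂ)) ψ)) (D * 2 ^ N), fun k => ?_⟩
  cases k with
  | zero => exact le_max_of_le_left (by simp)
  | succ k =>
    refine le_max_of_le_right ?_
    have h := seminorm_smulLeftCLM_le (hφ.hasTemperateGrowth (k + 1)) (n := b) (C := C₀)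
      (R := 2 ^ k) ?_ (by positivity) ?_ ψ a N
    · rw [le_div_iff₀ (by positivity)] at h
      calc _ = SchwartzMap.seminorm ℂ a b (smulLeftCLM ℂ
            (fun x => (dyadicPiece φ₀ (k + 1) x : ℂ)) ψ) * (2 ^ k) ^ N * 2 ^ N := by
            rw [pow_succ, mul_pow]; ring
        _ ≤ _ := by gcongr
    · intro i hi x
      have : (fun x => (dyadicPiece φ₀ (k + 1) x : ℂ)) =
          fun x => (dyadicPiece φ₀ 1 (((2 : ℝ) ^ k)⁻¹ • x) : ℂ) := by
        ext x; rw [dyadicPiece_succ]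
      rw [this]
      refine norm_iteratedFDeriv_comp_smul_le (hφ.contDiff_complex 1) hi hC₀ ?_ x
      rw [abs_of_nonneg (by positivity)]
      exact inv_le_one_of_one_le₀ (one_le_pow₀ (by norm_num))
    · intro x hx
      rw [dyadicPiece_succ, hφ.dyadicPiece_one_eq_zero, Complex.ofReal_zero]
      rw [norm_smul, norm_inv, Real.norm_of_nonneg (by positivity),
        inv_mul_le_iff₀ (by positivity)]
      simpa using hx.le

/-- The Littlewood–Paley pieces of a Schwartz function decay rapidly, in frequency and space. -/
lemma IsDyadicGenerator.exists_bound_fourierMultiplier (hφ : IsDyadicGenerator φ₀)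
    (f : 𝓢(EuclideanSpace ℝ (Fin d), ℂ)) (N M : ℕ) :
    ∃ C : ℝ, 0 < C ∧ ∀ (k : ℕ) (x : EuclideanSpace ℝ (Fin d)),
      ‖fourierMultiplierCLM ℂ (fun x => (dyadicPiece φ₀ k x : ℂ)) f x‖ * (2 ^ k) ^ N *
        (1 + ‖x‖) ^ M ≤ C := by
  let p := schwartzSeminormFamily ℂ (EuclideanSpace ℝ (Fin d)) ℂ
  have hp : WithSeminorms p := schwartz_withSeminorms ℂ _ ℂ
  let Q : Seminorm ℂ 𝓢(EuclideanSpace ℝ (Fin d), ℂ) := (Finset.Iic ((M, 0) : ℕ × ℕ)).sup p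
  let A : 𝓢(EuclideanSpace ℝ (Fin d), ℂ) →L[ℂ] 𝓢(EuclideanSpace ℝ (Fin d), ℂ) :=
    fourierInvCLM ℂ _
  have hQ : Continuous Q :=
    Seminorm.continuous_finsetSup fun i _ => hp.continuous_seminorm i
  -- By continuity of the inverse Fourier transform, spatial decay of the piece is controlled by
  -- finitely many seminorms on the frequency side, each of which gains `(2 ^ k) ^ (-N)`.
  obtain ⟨s, C₁, -, hC₁⟩ := Seminorm.bound_of_continuous hp (Q.comp A.toLinearMap)
    (hQ.comp A.continuous)
  choose B hB using fun i : ℕ × ℕ => hφ.exists_seminorm_mul_le (𝓕 f) N i.1 i.2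
  have hB0 : ∀ i, 0 ≤ B i := fun i => le_trans (by positivity) (hB i 0)
  refine ⟨2 ^ M * (C₁ * ∑ i ∈ s, B i) + 1,
    by have := Finset.sum_nonneg fun i (_ : i ∈ s) => hB0 i; positivity, fun k x => ?_⟩
  set ψ := smulLeftCLM ℂ (fun x => (dyadicPiece φ₀ k x : ℂ)) (𝓕 f) with hψ
  have h1 : fourierMultiplierCLM ℂ (fun x => (dyadicPiece φ₀ k x : ℂ)) f = A ψ := rfl
  have h2 := one_add_le_sup_seminorm_apply (𝕜 := ℂ) (m := (M, 0)) (k := M) (n := 0) le_rfl le_rfl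
    (A ψ) x
  rw [norm_iteratedFDeriv_zero] at h2
  have h3 : Q (A ψ) ≤ C₁ * s.sup p ψ := hC₁ ψ
  have h4 : s.sup p ψ ≤ ∑ i ∈ s, p i ψ := by
    have := Seminorm.finset_sup_le_sum p s ψ
    simpa [_root_.sum_apply] using this
  have h5 : (∑ i ∈ s, p i ψ) * (2 ^ k) ^ N ≤ ∑ i ∈ s, B i := by
    rw [Finset.sum_mul]
    exact Finset.sum_le_sum fun i _ => hB i k
  rw [h1]
  calc _ = (1 + ‖x‖) ^ M * ‖A ψ x‖ * (2 ^ k) ^ N := by ring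
    _ ≤ 2 ^ M * Q (A ψ) * (2 ^ k) ^ N := mul_le_mul_of_nonneg_right h2 (by positivity)
    _ ≤ 2 ^ M * (C₁ * ∑ i ∈ s, p i ψ) * (2 ^ k) ^ N := by
        gcongr
        exact h3.trans (by gcongr)
    _ = 2 ^ M * (C₁ * ((∑ i ∈ s, p i ψ) * (2 ^ k) ^ N)) := by ring
    _ ≤ 2 ^ M * (C₁ * ∑ i ∈ s, B i) := by gcongr
    _ ≤ _ := by linarith

end DyadicPieces

/-! ### Sequence and Morrey norms; membership of test functions -/

section UpperBounds

/-- The spare power in `s + 1 ≤ N` leaves terms dominated by `2⁻ᵏ A ^ r`. The geometric series sums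
to `2`, and `2 ^ (1 / r) ≤ 2` because `r ≥ 1`. -/
lemma weightedSeqNorm_le {s : ℝ} {q : ℝ≥0∞} (hq : 1 ≤ q) {N : ℝ} (hN : s + 1 ≤ N)
    {a : ℕ → ℝ≥0∞} {A : ℝ≥0∞} (ha : ∀ k : ℕ, a k ≤ (2 : ℝ≥0∞) ^ (-((k : ℝ) * N)) * A) :
    weightedSeqNorm s q a ≤ 2 * A := by
  unfold weightedSeqNorm
  split_ifs with hqt
  · refine iSup_le fun k => ?_
    calc (2 : ℝ≥0∞) ^ ((k : ℝ) * s) * a k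
        ≤ (2 : ℝ≥0∞) ^ ((k : ℝ) * s) * ((2 : ℝ≥0∞) ^ (-((k : ℝ) * N)) * A) := by
          gcongr; exact ha k
      _ = (2 : ℝ≥0∞) ^ ((k : ℝ) * s + -((k : ℝ) * N)) * A := by
          rw [ENNReal.rpow_add _ _ (by norm_num) (by norm_num), mul_assoc]
      _ ≤ (2 : ℝ≥0∞) ^ (1 : ℝ) * A := by
          gcongr
          · norm_num
          · have : (k : ℝ) * (s - N) ≤ 0 :=
              mul_nonpos_of_nonneg_of_nonpos (Nat.cast_nonneg k) (by linarith)
            linarith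
      _ = 2 * A := by simp
  · have hr1 : 1 ≤ q.toReal := by
      rw [← ENNReal.toReal_one]; exact ENNReal.toReal_mono hqt hq
    set r := q.toReal
    have hr0 : 0 < r := by linarith
    have h1 : ∀ k : ℕ, (2 : ℝ≥0∞) ^ ((k : ℝ) * s * r) * a k ^ r ≤ (2⁻¹) ^ k * A ^ r := by
      intro k
      calc (2 : ℝ≥0∞) ^ ((k : ℝ) * s * r) * a k ^ r
          ≤ (2 : ℝ≥0∞) ^ ((k : ℝ) * s * r) * ((2 : ℝ≥0∞) ^ (-((k : ℝ) * N)) * A) ^ r := by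
            gcongr; exact ha k
        _ = (2 : ℝ≥0∞) ^ ((k : ℝ) * s * r + -((k : ℝ) * N) * r) * A ^ r := by
            rw [ENNReal.mul_rpow_of_nonneg _ _ hr0.le, ← ENNReal.rpow_mul,
              ENNReal.rpow_add _ _ (by norm_num) (by norm_num), mul_assoc (_ ^ _)]
        _ ≤ (2 : ℝ≥0∞) ^ (-(k : ℝ)) * A ^ r := by
            gcongr
            · norm_num
            · have h2 : (N - s) * r ≥ 1 := by nlinarith
              have := mul_le_mul_of_nonneg_left h2 (Nat.cast_nonneg (α := ℝ) k)
              linarith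
        _ = (2⁻¹) ^ k * A ^ r := by
            rw [ENNReal.rpow_neg, ENNReal.rpow_natCast, ENNReal.inv_pow]
    calc (∑' k : ℕ, (2 : ℝ≥0∞) ^ ((k : ℝ) * s * r) * a k ^ r) ^ (1 / r)
        ≤ (2 * A ^ r) ^ (1 / r) := by
          gcongr
          refine (ENNReal.tsum_le_tsum h1).trans ?_
          rw [ENNReal.tsum_mul_right, ENNReal.tsum_geometric, ENNReal.one_sub_inv_two, inv_inv]
      _ = 2 ^ (1 / r) * A := by
          rw [ENNReal.mul_rpow_of_nonneg _ _ (by positivity), ← ENNReal.rpow_mul,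
            mul_one_div_cancel hr0.ne', ENNReal.rpow_one]
      _ ≤ 2 ^ (1 : ℝ) * A := by
          gcongr
          · norm_num
          · rw [div_le_one hr0]; exact hr1
      _ = 2 * A := by simp

lemma le_weightedSeqNorm {s : ℝ} {q : ℝ≥0∞} (hq : 1 ≤ q) (a : ℕ → ℝ≥0∞) (k : ℕ) :
    (2 : ℝ≥0∞) ^ ((k : ℝ) * s) * a k ≤ weightedSeqNorm s q a := by
  unfold weightedSeqNorm
  split_ifs with hqt
  · exact le_iSup (fun k : ℕ => (2 : ℝ≥0∞) ^ ((k : ℝ) * s) * a k) k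
  · have hr0 : 0 < q.toReal := ENNReal.toReal_pos (by positivity) hqt
    calc (2 : ℝ≥0∞) ^ ((k : ℝ) * s) * a k
        = ((2 : ℝ≥0∞) ^ ((k : ℝ) * s * q.toReal) * a k ^ q.toReal) ^ (1 / q.toReal) := by
          rw [ENNReal.rpow_mul 2 ((k : ℝ) * s), ← ENNReal.mul_rpow_of_nonneg _ _ hr0.le, ← ENNReal.rpow_mul,
            mul_one_div_cancel hr0.ne', ENNReal.rpow_one]
      _ ≤ _ := by
          gcongr
          exact ENNReal.le_tsum (f := fun k : ℕ =>
            (2 : ℝ≥0∞) ^ ((k : ℝ) * s * q.toReal) * a k ^ q.toReal) k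

lemma le_morreyNorm {d : ℕ} (u p : ℝ) (g : EuclideanSpace ℝ (Fin d) → ℝ≥0∞)
    (y : EuclideanSpace ℝ (Fin d)) {r : ℝ} (hr : 0 < r) :
    volume (Metric.ball y r) ^ (1 / u - 1 / p) *
      (∫⁻ x in Metric.ball y r, g x ^ p) ^ (1 / p) ≤ morreyNorm u p g := by
  unfold morreyNorm
  exact le_iSup_of_le y (le_iSup_of_le r (le_iSup_of_le hr le_rfl))

/-- Balls of volume at most `1` are handled by the uniform bound, which leaves `V ^ (1 / u) ≤ 1`;
larger balls by the global `L^p` norm, since `1 / u - 1 / p ≤ 0`. The decay weight is integrable and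
at most `1`, hence so is its `p`-th power. -/
lemma morreyNorm_lt_top {d : ℕ} {u p : ℝ} (hp : 1 ≤ p) (hpu : p ≤ u)
    {g : EuclideanSpace ℝ (Fin d) → ℝ≥0∞} {C : ℝ≥0∞} (hC : C ≠ ⊤)
    (hg : ∀ x, g x ≤ C * ENNReal.ofReal ((1 + ‖x‖) ^ (-((d : ℝ) + 1)))) :
    morreyNorm u p g < ⊤ := by
  have hp0 : 0 < p := by linarith
  have hu0 : 0 < u := by linarith
  have hw1 : ∀ x : EuclideanSpace ℝ (Fin d),
      ENNReal.ofReal ((1 + ‖x‖) ^ (-((d : ℝ) + 1))) ≤ 1 := fun x => by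
    rw [ENNReal.ofReal_le_one]
    exact Real.rpow_le_one_of_one_le_of_nonpos (by linarith [norm_nonneg x]) (by linarith)
  have hgC : ∀ x, g x ≤ C := fun x => (hg x).trans (mul_le_of_le_one_right' (hw1 x))
  have hint : ∫⁻ x, g x ^ p < ⊤ := by
    have h1 : ∀ x, g x ^ p ≤ C ^ p * ENNReal.ofReal ((1 + ‖x‖) ^ (-((d : ℝ) + 1))) := by
      intro x
      calc g x ^ p ≤ (C * ENNReal.ofReal ((1 + ‖x‖) ^ (-((d : ℝ) + 1)))) ^ p := by
            gcongr; exact hg x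
        _ = C ^ p * ENNReal.ofReal ((1 + ‖x‖) ^ (-((d : ℝ) + 1))) ^ p :=
            ENNReal.mul_rpow_of_nonneg _ _ hp0.le
        _ ≤ C ^ p * ENNReal.ofReal ((1 + ‖x‖) ^ (-((d : ℝ) + 1))) ^ (1 : ℝ) := by
            exact mul_le_mul_right (ENNReal.rpow_le_rpow_of_exponent_ge (hw1 x) hp) _
        _ = _ := by rw [ENNReal.rpow_one]
    refine (lintegral_mono h1).trans_lt ?_
    rw [lintegral_const_mul' _ _ (ENNReal.rpow_ne_top_of_nonneg hp0.le hC)]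
    refine ENNReal.mul_lt_top (ENNReal.rpow_lt_top_of_nonneg hp0.le hC) ?_
    exact finite_integral_one_add_norm (by simp)
  have hle : morreyNorm u p g ≤ C + (∫⁻ x, g x ^ p) ^ (1 / p) := by
    unfold morreyNorm
    refine iSup_le fun y => iSup_le fun r => iSup_le fun hr => ?_
    set V := volume (Metric.ball y r) with hV
    have hV0 : V ≠ 0 := (Metric.measure_ball_pos volume y hr).ne'
    have hVt : V ≠ ⊤ := measure_ball_lt_top.ne
    rcases le_total V 1 with hV1 | hV1
    · refine le_add_right ?_
      calc V ^ (1 / u - 1 / p) * (∫⁻ x in Metric.ball y r, g x ^ p) ^ (1 / p)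
          ≤ V ^ (1 / u - 1 / p) * (C ^ p * V) ^ (1 / p) := by
            gcongr
            refine (lintegral_mono (g := fun _ => C ^ p) fun x => ?_).trans ?_
            · exact ENNReal.rpow_le_rpow (hgC x) hp0.le
            · rw [setLIntegral_const]
        _ = V ^ (1 / u - 1 / p + 1 / p) * C := by
            rw [ENNReal.mul_rpow_of_nonneg _ _ (by positivity), ← ENNReal.rpow_mul,
              mul_one_div_cancel hp0.ne', ENNReal.rpow_one, ENNReal.rpow_add _ _ hV0 hVt]
            ring
        _ ≤ 1 * C := by
            gcongr
            exact ENNReal.rpow_le_one hV1 (by rw [sub_add_cancel]; positivity)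
        _ = C := one_mul C
    · refine le_add_left ?_
      calc V ^ (1 / u - 1 / p) * (∫⁻ x in Metric.ball y r, g x ^ p) ^ (1 / p)
          ≤ 1 * (∫⁻ x, g x ^ p) ^ (1 / p) := by
            gcongr
            · have h0 : 1 / u - 1 / p ≤ 0 := by
                have := one_div_le_one_div_of_le hp0 hpu
                linarith
              have := ENNReal.rpow_le_rpow_of_exponent_le hV1 h0
              simpa using this
            · exact Measure.restrict_le_self
        _ = _ := one_mul _
  refine hle.trans_lt (ENNReal.add_lt_top.2 ⟨hC.lt_top, ?_⟩)
  exact ENNReal.rpow_lt_top_of_nonneg (by positivity) hint.ne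

/-- Smooth compactly supported functions belong to every Triebel–Lizorkin–Morrey space. -/
lemma mem_triebelLizorkinMorrey_of_contDiff {d : ℕ} {φ₀ : EuclideanSpace ℝ (Fin d) → ℝ}
    (hφ : IsDyadicGenerator φ₀) {u p : ℝ} (hp : 1 ≤ p) (hpu : p ≤ u) (s : ℝ) {q : ℝ≥0∞}
    (hq : 1 ≤ q) {f : EuclideanSpace ℝ (Fin d) → ℝ} (hf : ContDiff ℝ ∞ f)
    (hfc : HasCompactSupport f) : f ∈ triebelLizorkinMorrey φ₀ s u p q := by
  let F : 𝓢(EuclideanSpace ℝ (Fin d), ℂ) := HasCompactSupport.toSchwartzMap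
    (hfc.comp_left (g := fun r : ℝ => (r : ℂ)) Complex.ofReal_zero) hf.complex_ofReal
  -- `N` beats the weight `2^{ks}` with one power to spare; the spatial order `d + 1` makes the
  -- decay integrable.
  obtain ⟨N, hN⟩ := exists_nat_ge (s + 1)
  obtain ⟨C, hC0, hC⟩ := hφ.exists_bound_fourierMultiplier F N (d + 1)
  refine ⟨(F : 𝓢'(EuclideanSpace ℝ (Fin d), ℂ)),
    fun k => SchwartzMap.fourierMultiplierCLM ℂ (fun x => (dyadicPiece φ₀ k x : ℂ)) F,
    ⟨hf.continuous.locallyIntegrable, fun ψ _ => ?_⟩, fun k => ?_, ?_⟩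
  · exact toTemperedDistributionCLM_apply_apply volume F ψ
  · refine ⟨SchwartzMap.hasTemperateGrowth _, ?_⟩
    rw [TemperedDistribution.fourierMultiplierCLM_toTemperedDistributionCLM_eq
      (hφ.hasTemperateGrowth k)]
    ext ψ
    simp
  · refine morreyNorm_lt_top hp hpu (C := 2 * ENNReal.ofReal C)
      (ENNReal.mul_ne_top (by norm_num) ENNReal.ofReal_ne_top) fun x => ?_
    rw [mul_assoc]
    refine weightedSeqNorm_le hq hN fun k => ?_
    have h1 := hC k x
    have hx : 0 < 1 + ‖x‖ := by positivity
    rw [← le_div_iff₀ (by positivity), ← le_div_iff₀ (by positivity)] at h1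
    rw [← ofReal_norm]
    have h2 : (2 : ℝ≥0∞) ^ (-((k : ℝ) * N)) = ENNReal.ofReal (((2 ^ k) ^ N)⁻¹) := by
      rw [ENNReal.rpow_neg, ← Nat.cast_mul, ENNReal.rpow_natCast, ← pow_mul,
        ENNReal.ofReal_inv_of_pos (by positivity), ENNReal.ofReal_pow (by norm_num)]
      simp
    rw [h2, ← ENNReal.ofReal_mul hC0.le, ← ENNReal.ofReal_mul (by positivity)]
    refine ENNReal.ofReal_le_ofReal (h1.trans (le_of_eq ?_))
    rw [Real.rpow_neg hx.le]
    have : (1 + ‖x‖) ^ ((d : ℝ) + 1) = (1 + ‖x‖) ^ (d + 1) := by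
      rw [← Real.rpow_natCast]; push_cast; rfl
    rw [this]
    field_simp

end UpperBounds

/-! ### Littlewood–Paley pieces as rescaled convolutions -/

section Representation

variable {d : ℕ}

local notation "𝔼" => EuclideanSpace ℝ (Fin d)

/-- Integration against `h ∈ L¹` is itself a tempered distribution and agrees with `T` on compactly
supported test functions; density extends the formula to all Schwartz functions. -/
lemma IsRegularDistribution.apply_eq_integral {h : 𝔼 → ℝ} (hh : Continuous h)
    (hc : HasCompactSupport h) {T : 𝓢'(𝔼, ℂ)} (hT : IsRegularDistribution h T) (ψ : 𝓢(𝔼, ℂ)) :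
    T ψ = ∫ x, ψ x * (h x : ℂ) := by
  have hcc : HasCompactSupport fun x => (h x : ℂ) :=
    hc.comp_left (g := fun r : ℝ => (r : ℂ)) Complex.ofReal_zero
  have hmem : MemLp (fun x => (h x : ℂ)) 1 volume :=
    (Complex.continuous_ofReal.comp hh).memLp_of_hasCompactSupport hcc
  have : Fact ((1 : ℝ≥0∞) ≤ 1) := ⟨le_rfl⟩
  have h1 : ∀ ψ : 𝓢(𝔼, ℂ), Lp.toTemperedDistribution (hmem.toLp _) ψ
      = ∫ x, ψ x * (h x : ℂ) := by
    intro ψ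
    rw [Lp.toTemperedDistribution_apply]
    refine integral_congr_ae ?_
    filter_upwards [hmem.coeFn_toLp] with x hx
    rw [hx, smul_eq_mul]
  rw [← h1]
  exact temperedDistribution_ext_of_hasCompactSupport
    (fun ψ hψ => by rw [h1]; exact hT.2 ψ hψ) ψ

lemma fourierInv_comp_smul {V : Type*} [NormedAddCommGroup V] [InnerProductSpace ℝ V]
    [FiniteDimensional ℝ V] [MeasurableSpace V] [BorelSpace V] (φ : V → ℂ) {ε : ℝ} (hε : 0 < ε)
    (y : V) :
    𝓕⁻ (fun ξ => φ (ε • ξ)) (ε • y) = ((ε ^ Module.finrank ℝ V)⁻¹ : ℝ) • 𝓕⁻ φ y := by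
  rw [Real.fourierInv_eq, Real.fourierInv_eq]
  have := Measure.integral_comp_smul (volume : Measure V)
    (fun v => Real.fourierChar (inner ℝ v y) • φ v) ε
  rw [abs_of_pos (by positivity)] at this
  rw [← this]
  simp only [inner_smul_left, inner_smul_right]
  rfl

/-- A multiplier transposed: `𝓕 (φ(ε ·) 𝓕⁻ ψ)` as a rescaled convolution. -/
lemma fourier_smulLeftCLM_fourierInv (φ : 𝓢(𝔼, ℂ)) {ε : ℝ} (hε : 0 < ε) {m : 𝔼 → ℂ}
    (hm : m.HasTemperateGrowth) (hmφ : ∀ x, m x = φ (ε • x)) (ψ : 𝓢(𝔼, ℂ)) (y : 𝔼) :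
    𝓕 (smulLeftCLM ℂ m (𝓕⁻ ψ)) y = ∫ t, (𝓕⁻ φ) t * ψ (y + ε • t) := by
  let e : 𝔼 ≃L[ℝ] 𝔼 := ContinuousLinearEquiv.smulLeft (Units.mk0 ε hε.ne')
  let Φ : 𝓢(𝔼, ℂ) := compCLMOfContinuousLinearEquiv ℂ e φ
  have hΦ : ∀ x, Φ x = φ (ε • x) := fun x => rfl
  -- Reflection turns `𝓕⁻ ψ` into `𝓕 r`, so that `m · 𝓕⁻ ψ` is a product of two Fourier transforms,
  -- the form through which Schwartz convolution is defined.
  let r : 𝓢(𝔼, ℂ) := compCLMOfContinuousLinearEquiv ℂ (ContinuousLinearEquiv.neg ℝ) ψ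
  have hr : ∀ x, r x = ψ (-x) := fun x => rfl
  have h1 : (𝓕 (smulLeftCLM ℂ m (𝓕⁻ ψ)) : 𝓢(𝔼, ℂ)) y =
      (SchwartzMap.convolution (ContinuousLinearMap.mul ℂ ℂ) (𝓕⁻ Φ) r) (-y) := by
    have h2 : pairing (ContinuousLinearMap.mul ℂ ℂ) (𝓕 (𝓕⁻ Φ)) (𝓕 r) =
        smulLeftCLM ℂ m (𝓕⁻ ψ) := by
      ext x
      rw [pairing_apply_apply, smulLeftCLM_apply_apply hm, FourierTransform.fourier_fourierInv_eq,
        hmφ, ← hΦ]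
      simp only [ContinuousLinearMap.mul_apply', smul_eq_mul]
      congr 1
      rw [fourier_coe, fourierInv_coe, Real.fourierInv_eq_fourier_comp_neg]
      rfl
    have h3 : SchwartzMap.convolution (ContinuousLinearMap.mul ℂ ℂ) (𝓕⁻ Φ) r =
        𝓕⁻ (pairing (ContinuousLinearMap.mul ℂ ℂ) (𝓕 (𝓕⁻ Φ)) (𝓕 r)) := rfl
    rw [h3, h2, fourierInv_coe, fourier_coe, Real.fourierInv_eq_fourier_neg, neg_neg]
  rw [h1, SchwartzMap.convolution_apply, MeasureTheory.convolution_def]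
  simp only [ContinuousLinearMap.mul_apply', hr]
  have h4 := Measure.integral_comp_smul (volume : Measure 𝔼)
    (fun t => (𝓕⁻ Φ) t * ψ (-(-y - t))) ε
  rw [abs_of_pos (by positivity)] at h4
  have h5 : ∀ t, (𝓕⁻ Φ) (ε • t) * ψ (-(-y - ε • t)) =
      ((ε ^ Module.finrank ℝ 𝔼)⁻¹ : ℝ) • ((𝓕⁻ φ) t * ψ (y + ε • t)) := by
    intro t
    have : (𝓕⁻ Φ : 𝓢(𝔼, ℂ)) (ε • t) = ((ε ^ Module.finrank ℝ 𝔼)⁻¹ : ℝ) • (𝓕⁻ φ) t := by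
      rw [fourierInv_coe, fourierInv_coe]
      exact fourierInv_comp_smul φ hε t
    rw [this, smul_mul_assoc]
    congr 3
    abel
  simp_rw [h5] at h4
  rw [integral_smul] at h4
  exact (smul_right_injective ℂ (r := ((ε ^ Module.finrank ℝ 𝔼)⁻¹ : ℝ))
    (by positivity) h4).symm

/-- Fubini and the translation `y = z - ε • t` move the convolution from the test function onto `h`.
-/
lemma integral_mul_integral_comp_add {h : 𝔼 → ℝ} (hh : Continuous h)
    (hc : HasCompactSupport h) (K ψ : 𝓢(𝔼, ℂ)) (ε : ℝ) :
    ∫ y, (∫ t, K t * ψ (y + ε • t)) * (h y : ℂ) =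
      ∫ z, ψ z * ∫ t, K t * (h (z - ε • t) : ℂ) := by
  have hcc : HasCompactSupport fun x => (h x : ℂ) :=
    hc.comp_left (g := fun r : ℝ => (r : ℂ)) Complex.ofReal_zero
  have hhc : Continuous fun x => (h x : ℂ) := Complex.continuous_ofReal.comp hh
  have hhi : Integrable fun x => (h x : ℂ) := hhc.integrable_of_hasCompactSupport hcc
  obtain ⟨B, hB⟩ := hcc.exists_bound_of_continuous hhc
  have i1 : Integrable (fun z : 𝔼 × 𝔼 => ψ (z.1 + ε • z.2) * ((h z.1 : ℂ) * K z.2))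
      (volume.prod volume) := by
    refine (hhi.mul_prod K.integrable).bdd_mul (c := SchwartzMap.seminorm ℂ 0 0 ψ) ?_ ?_
    · exact (ψ.continuous.comp (by fun_prop)).aestronglyMeasurable
    · exact Filter.Eventually.of_forall fun z => SchwartzMap.norm_le_seminorm ℂ ψ _
  have i2 : Integrable (fun z : 𝔼 × 𝔼 => (h (z.1 - ε • z.2) : ℂ) * (ψ z.1 * K z.2))
      (volume.prod volume) := by
    refine (ψ.integrable.mul_prod K.integrable).bdd_mul (c := B) ?_ ?_
    · exact (hhc.comp (by fun_prop)).aestronglyMeasurable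
    · exact Filter.Eventually.of_forall fun z => hB _
  calc ∫ y, (∫ t, K t * ψ (y + ε • t)) * (h y : ℂ)
      = ∫ y, ∫ t, ψ (y + ε • t) * ((h y : ℂ) * K t) := by
        refine integral_congr_ae (Filter.Eventually.of_forall fun y => ?_)
        simp only
        rw [← integral_mul_const]
        congr 1; ext t; ring
    _ = ∫ t, ∫ y, ψ (y + ε • t) * ((h y : ℂ) * K t) := integral_integral_swap i1
    _ = ∫ t, ∫ z, (h (z - ε • t) : ℂ) * (ψ z * K t) := by
        refine integral_congr_ae (Filter.Eventually.of_forall fun t => ?_)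
        simp only
        rw [← integral_add_right_eq_self (fun z => (h (z - ε • t) : ℂ) * (ψ z * K t)) (ε • t)]
        congr 1; ext y
        rw [add_sub_cancel_right]; ring
    _ = ∫ z, ∫ t, (h (z - ε • t) : ℂ) * (ψ z * K t) := (integral_integral_swap i2).symm
    _ = _ := by
        refine integral_congr_ae (Filter.Eventually.of_forall fun z => ?_)
        simp only
        rw [← integral_const_mul]
        congr 1; ext t; ring

lemma continuous_integral_mul_comp_sub {h : 𝔼 → ℝ} (hh : Continuous h)
    (hc : HasCompactSupport h) (K : 𝓢(𝔼, ℂ)) (ε : ℝ) :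
    Continuous fun z => ∫ t, K t * (h (z - ε • t) : ℂ) := by
  obtain ⟨B, hB⟩ := hc.exists_bound_of_continuous hh
  refine continuous_of_dominated (bound := fun t => ‖K t‖ * B) (fun z => ?_) (fun z => ?_)
    (K.integrable.norm.mul_const B) ?_
  · exact (K.continuous.mul (Complex.continuous_ofReal.comp
      (hh.comp (by fun_prop)))).aestronglyMeasurable
  · refine Filter.Eventually.of_forall fun t => ?_
    rw [norm_mul, Complex.norm_real]
    gcongr
    exact hB _
  · refine Filter.Eventually.of_forall fun t => ?_
    exact continuous_const.mul (Complex.continuous_ofReal.comp (hh.comp (by fun_prop)))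

/-- The convolution kernel `𝓕⁻¹ φ₁` of the first dyadic piece. -/
def IsDyadicGenerator.kernel {φ₀ : 𝔼 → ℝ} (hφ : IsDyadicGenerator φ₀) : 𝓢(𝔼, ℂ) :=
  𝓕⁻ ((hφ.hasCompactSupport_complex 1).toSchwartzMap (hφ.contDiff_complex 1))

/-- The smooth function representing `𝓕⁻¹[φ_{k+1} 𝓕 h]` is a rescaled convolution of `h`. -/
lemma IsDyadicGenerator.eq_integral_kernel {φ₀ : 𝔼 → ℝ} (hφ : IsDyadicGenerator φ₀)
    {h : 𝔼 → ℝ} (hh : Continuous h) (hc : HasCompactSupport h) {T : 𝓢'(𝔼, ℂ)}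
    (hT : IsRegularDistribution h T) {k : ℕ} {g : 𝔼 → ℂ}
    (hg : RepresentsMultiplier (dyadicPiece φ₀ (k + 1)) T g) (x : 𝔼) :
    g x = ∫ t, hφ.kernel t * (h (x - ((2 : ℝ) ^ k)⁻¹ • t) : ℂ) := by
  obtain ⟨hgt, hgT⟩ := hg
  have hcont := continuous_integral_mul_comp_sub hh hc hφ.kernel ((2 : ℝ) ^ k)⁻¹
  have hgc : Continuous g := hgt.1.continuous
  have key : ∀ ψ : 𝓢(𝔼, ℂ), ∫ z, ψ z * g z =
      ∫ z, ψ z * ∫ t, hφ.kernel t * (h (z - ((2 : ℝ) ^ k)⁻¹ • t) : ℂ) := by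
    intro ψ
    have h1 : ∫ z, ψ z * g z = hgt.toTemperedDistribution volume ψ := by
      exact (Function.HasTemperateGrowth.toTemperedDistribution_apply volume hgt ψ).symm
    rw [h1, hgT, TemperedDistribution.fourierMultiplierCLM_apply_apply,
      hT.apply_eq_integral hh hc, ← integral_mul_integral_comp_add hh hc]
    congr 1
    ext y
    rw [fourier_smulLeftCLM_fourierInv
      ((hφ.hasCompactSupport_complex 1).toSchwartzMap (hφ.contDiff_complex 1))
      (by positivity : (0 : ℝ) < ((2 : ℝ) ^ k)⁻¹) (hφ.hasTemperateGrowth (k + 1))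
      (fun x => by rw [dyadicPiece_succ]; rfl)]
    rfl
  -- Equality as distributions gives equality almost everywhere, and continuity of both sides
  -- upgrades it to every point.
  have hae := ae_eq_of_integral_contDiff_smul_eq (μ := volume) hgc.locallyIntegrable
    hcont.locallyIntegrable fun η hη hηc => by
      have := key (HasCompactSupport.toSchwartzMap
        (hηc.comp_left (g := fun r : ℝ => (r : ℂ)) Complex.ofReal_zero) hη.complex_ofReal)
      simp only [Complex.real_smul]
      exact this
  exact congrFun (Continuous.ae_eq_iff_eq volume hgc hcont |>.1 hae) x

end Representation

/-! ### The hat function and its Fourier transform -/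

section HatFunction

/-- The hat function of width `e`, as a second difference of the absolute value. -/
def hatFun (e t : ℝ) : ℝ := |t - e| + |t + e| - 2 * |t|

lemma continuous_hatFun (e : ℝ) : Continuous (hatFun e) := by
  unfold hatFun; fun_prop

lemma hatFun_nonneg (e t : ℝ) : 0 ≤ hatFun e t := by
  unfold hatFun
  have := abs_add_le (t - e) (t + e)
  rw [show t - e + (t + e) = 2 * t by ring, abs_mul, abs_two] at this
  linarith

lemma hatFun_eq_zero {e t : ℝ} (he : 0 < e) (ht : e ≤ |t|) : hatFun e t = 0 := by
  unfold hatFun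
  rcases le_abs'.1 ht with h | h
  · rw [abs_of_nonpos (by linarith), abs_of_nonpos (by linarith), abs_of_nonpos (by linarith)]
    ring
  · rw [abs_of_nonneg (by linarith), abs_of_nonneg (by linarith), abs_of_nonneg (by linarith)]
    ring

lemma hasCompactSupport_hatFun {e : ℝ} (he : 0 < e) : HasCompactSupport (hatFun e) := by
  refine HasCompactSupport.intro (isCompact_closedBall 0 e) fun x hx => hatFun_eq_zero he ?_
  simp only [Metric.mem_closedBall, dist_zero_right, not_le, Real.norm_eq_abs] at hx
  exact hx.le

/-- The real part is the integral of `cos(2πtw)` against the hat. On the support the phase is at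
most `π / 2`, so the integrand is nonnegative, and it is positive at `0`. -/
lemma integral_fourierChar_mul_hatFun_ne_zero {w e : ℝ} (he : 0 < e)
    (hwe : |w| * e ≤ 1 / 4) :
    ∫ t, (Real.fourierChar (-(t * w)) : ℂ) * (hatFun e t : ℂ) ≠ 0 := by
  have hint : Integrable fun t : ℝ => (Real.fourierChar (-(t * w)) : ℂ) * (hatFun e t : ℂ) := by
    refine Continuous.integrable_of_hasCompactSupport ?_ ?_
    · exact (continuous_induced_dom.comp
        (Real.continuous_fourierChar.comp (by fun_prop))).mul
        (Complex.continuous_ofReal.comp (continuous_hatFun e))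
    · exact ((hasCompactSupport_hatFun he).comp_left (g := fun r : ℝ => (r : ℂ))
        Complex.ofReal_zero).mul_left
  intro h0
  have hre : ∫ t : ℝ, Real.cos (2 * Real.pi * (t * w)) * hatFun e t = 0 := by
    have h1 := integral_re (𝕜 := ℂ) hint
    rw [h0] at h1
    simp only [RCLike.re_to_complex, Complex.zero_re] at h1
    rw [← h1]
    congr 1
    ext t
    rw [Complex.re_mul_ofReal, Real.fourierChar_apply]
    congr 1
    have := Complex.exp_ofReal_mul_I_re (2 * Real.pi * -(t * w))
    rw [this, mul_neg, Real.cos_neg]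
  have hpos : 0 < ∫ t : ℝ, Real.cos (2 * Real.pi * (t * w)) * hatFun e t := by
    refine Continuous.integral_pos_of_hasCompactSupport_nonneg_nonzero (x := 0) ?_ ?_ ?_ ?_
    · exact (Real.continuous_cos.comp (by fun_prop)).mul (continuous_hatFun e)
    · exact (hasCompactSupport_hatFun he).mul_left
    · intro t
      rcases le_or_gt e |t| with ht | ht
      · simp [hatFun_eq_zero he ht]
      · refine mul_nonneg (Real.cos_nonneg_of_mem_Icc ?_) (hatFun_nonneg e t)
        have h1 : |2 * Real.pi * (t * w)| ≤ Real.pi / 2 := by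
          rw [abs_mul, abs_mul t, abs_of_pos Real.two_pi_pos]
          have : |t| * |w| ≤ 1 / 4 :=
            (mul_le_mul_of_nonneg_right ht.le (abs_nonneg w)).trans (by linarith)
          nlinarith [Real.pi_pos]
        exact ⟨(abs_le.1 h1).1.trans' (by linarith), (abs_le.1 h1).2⟩
    · simp [hatFun, abs_of_pos he, he.ne']
  exact hpos.ne' hre

end HatFunction

/-! ### The limiting profile of a kink at small scales -/

section Profile

variable {d : ℕ}

local notation "𝔼" => EuclideanSpace ℝ (Fin d)

/-- The convolution of a kernel with `α |x_i| + β x_i`, as a function of `x_i`. -/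
def profile (K : 𝓢(𝔼, ℂ)) (i : Fin d) (α β t : ℝ) : ℂ :=
  ∫ y, K y * ((α * |t - y i| + β * (t - y i) : ℝ) : ℂ)

lemma abs_coord_le_norm (y : 𝔼) (i : Fin d) : |y i| ≤ ‖y‖ := by
  simpa using PiLp.norm_apply_le y i

lemma integrable_profile (K : 𝓢(𝔼, ℂ)) (i : Fin d) (α β t : ℝ) :
    Integrable fun y : 𝔼 => K y * ((α * |t - y i| + β * (t - y i) : ℝ) : ℂ) := by
  have hb : Integrable fun y : 𝔼 => (|α| + |β|) * (|t| * ‖K y‖ + ‖y‖ ^ 1 * ‖K y‖) :=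
    ((K.integrable.norm.const_mul |t|).add (K.integrable_pow_mul volume 1)).const_mul _
  refine hb.mono' ?_ (Filter.Eventually.of_forall fun y => ?_)
  · exact (K.continuous.mul (Complex.continuous_ofReal.comp
      (by fun_prop))).aestronglyMeasurable
  · rw [norm_mul, Complex.norm_real, Real.norm_eq_abs]
    have h1 : |t - y i| ≤ |t| + ‖y‖ :=
      (abs_sub _ _).trans (by gcongr; exact abs_coord_le_norm y i)
    have h2 : |α * |t - y i| + β * (t - y i)| ≤ (|α| + |β|) * (|t| + ‖y‖) := by
      refine (abs_add_le _ _).trans ?_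
      rw [abs_mul, abs_mul, abs_abs, ← add_mul]
      gcongr
    calc ‖K y‖ * |α * |t - y i| + β * (t - y i)|
        ≤ ‖K y‖ * ((|α| + |β|) * (|t| + ‖y‖)) := by gcongr
      _ = _ := by ring

lemma continuous_profile (K : 𝓢(𝔼, ℂ)) (i : Fin d) (α β : ℝ) :
    Continuous (profile K i α β) := by
  refine (LipschitzWith.of_dist_le_mul (K := ((|α| + |β|) * ∫ y, ‖K y‖).toNNReal)
    fun t t' => ?_).continuous
  have h0 : 0 ≤ ∫ y, ‖K y‖ := integral_nonneg fun y => norm_nonneg _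
  rw [Real.coe_toNNReal _ (by positivity), dist_eq_norm, Real.dist_eq, profile, profile,
    ← integral_sub (integrable_profile K i α β t) (integrable_profile K i α β t')]
  refine (norm_integral_le_of_norm_le (g := fun y => ‖K y‖ * ((|α| + |β|) * |t - t'|))
    (K.integrable.norm.mul_const _) (Filter.Eventually.of_forall fun y => ?_)).trans
    (le_of_eq ?_)
  · rw [← mul_sub, norm_mul, ← Complex.ofReal_sub, Complex.norm_real, Real.norm_eq_abs]
    gcongr
    have h1 : α * |t - y i| + β * (t - y i) - (α * |t' - y i| + β * (t' - y i)) =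
      α * (|t - y i| - |t' - y i|) + β * (t - t') := by ring
    rw [h1]
    refine (abs_add_le _ _).trans ?_
    rw [abs_mul, abs_mul, add_mul]
    refine add_le_add (mul_le_mul_of_nonneg_left ?_ (abs_nonneg _)) le_rfl
    refine (abs_abs_sub_abs_le (t - y i) (t' - y i)).trans (le_of_eq ?_)
    congr 1; ring
  · rw [integral_mul_const]; ring

/-- A second difference kills the linear part and turns `|·|` into the compactly supported hat,
whose Fourier transform is an ordinary integral. -/
lemma profile_second_difference (K : 𝓢(𝔼, ℂ)) (i : Fin d) (α β e t : ℝ) :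
    profile K i α β (t + e) + profile K i α β (t - e) - 2 * profile K i α β t =
      α * ∫ y, K y * (hatFun e (t - y i) : ℂ) := by
  unfold profile
  rw [← integral_add (integrable_profile K i α β _) (integrable_profile K i α β _),
    ← integral_const_mul, ← integral_const_mul]
  rw [← integral_sub (by exact (integrable_profile K i α β _).add (integrable_profile K i α β _))
    ((integrable_profile K i α β _).const_mul 2)]
  congr 1
  ext y
  unfold hatFun
  rw [show t + e - y i = t - y i + e by ring, show t - e - y i = t - y i - e by ring]
  push_cast
  ring

/-- After Fubini, the shift `t ↦ t + y i` splits the character; the factor in `y` integrates to `𝓕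
K` at the point `w` of the `i`-th axis. -/
lemma integral_fourierChar_mul_conv_hatFun (K : 𝓢(𝔼, ℂ)) (i : Fin d) {e : ℝ} (he : 0 < e)
    (w : ℝ) :
    ∫ t, (Real.fourierChar (-(t * w)) : ℂ) * ∫ y, K y * (hatFun e (t - y i) : ℂ) =
      (𝓕 K) (EuclideanSpace.single i w) *
        ∫ t, (Real.fourierChar (-(t * w)) : ℂ) * (hatFun e t : ℂ) := by
  have hχ : Continuous fun t : ℝ => (Real.fourierChar (-(t * w)) : ℂ) :=
    continuous_induced_dom.comp (Real.continuous_fourierChar.comp (by fun_prop))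
  have hhc : Continuous fun t : ℝ => (hatFun e t : ℂ) :=
    Complex.continuous_ofReal.comp (continuous_hatFun e)
  have hhi : Integrable fun t : ℝ => (hatFun e t : ℂ) :=
    hhc.integrable_of_hasCompactSupport ((hasCompactSupport_hatFun he).comp_left
      (g := fun r : ℝ => (r : ℂ)) Complex.ofReal_zero)
  have hint : Integrable (fun z : 𝔼 × ℝ => (Real.fourierChar (-(z.2 * w)) : ℂ) *
      (K z.1 * (hatFun e (z.2 - z.1 i) : ℂ))) (volume.prod volume) := by
    have hcont : Continuous (fun z : 𝔼 × ℝ => (Real.fourierChar (-(z.2 * w)) : ℂ) *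
      (K z.1 * (hatFun e (z.2 - z.1 i) : ℂ))) :=
      (hχ.comp continuous_snd).mul ((K.continuous.comp continuous_fst).mul
        (hhc.comp (by fun_prop)))
    rw [integrable_prod_iff hcont.aestronglyMeasurable]
    refine ⟨Filter.Eventually.of_forall fun y => ?_, ?_⟩
    · refine Integrable.bdd_mul (c := 1) ((hhi.comp_sub_right (y i)).const_mul (K y))
        hχ.aestronglyMeasurable (Filter.Eventually.of_forall fun t => ?_)
      rw [Circle.norm_coe]
    · have : ∀ y : 𝔼, ∫ t : ℝ, ‖(Real.fourierChar (-(t * w)) : ℂ) *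
          (K y * (hatFun e (t - y i) : ℂ))‖ = ‖K y‖ * ∫ t, ‖(hatFun e t : ℂ)‖ := by
        intro y
        rw [← integral_sub_right_eq_self (fun t => ‖(hatFun e t : ℂ)‖) (y i),
          ← integral_const_mul]
        congr 1; ext t
        rw [norm_mul, norm_mul, Circle.norm_coe, one_mul]
      simp only [this]
      exact K.integrable.norm.mul_const _
  calc ∫ t, (Real.fourierChar (-(t * w)) : ℂ) * ∫ y, K y * (hatFun e (t - y i) : ℂ)
      = ∫ t, ∫ y, (Real.fourierChar (-(t * w)) : ℂ) * (K y * (hatFun e (t - y i) : ℂ)) := by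
        congr 1; ext t; rw [integral_const_mul]
    _ = ∫ y, ∫ t, (Real.fourierChar (-(t * w)) : ℂ) * (K y * (hatFun e (t - y i) : ℂ)) :=
        (integral_integral_swap hint).symm
    _ = ∫ y, (Real.fourierChar (-(y i * w)) : ℂ) * K y *
          ∫ t, (Real.fourierChar (-(t * w)) : ℂ) * (hatFun e t : ℂ) := by
        congr 1; ext y
        rw [← integral_const_mul, ← integral_add_right_eq_self _ (y i)]
        congr 1; ext t
        rw [add_sub_cancel_right, add_mul, neg_add, AddChar.map_add_eq_mul, Circle.coe_mul]
        ring
    _ = _ := by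
        rw [integral_mul_const, fourier_coe, Real.fourier_eq]
        congr 2
        ext y
        rw [EuclideanSpace.inner_single_right, Circle.smul_def, smul_eq_mul]
        simp [mul_comm]

/-- A vanishing profile would have vanishing second differences, contradicting that both factors of
their Fourier transform at `w` are nonzero when the width `e` is small against `1 / |w|`. -/
lemma exists_profile_ne_zero {K : 𝓢(𝔼, ℂ)} {i : Fin d} {w : ℝ}
    (hK : (𝓕 K) (EuclideanSpace.single i w) ≠ 0) {α : ℝ} (hα : α ≠ 0) (β : ℝ) :
    ∃ t, profile K i α β t ≠ 0 := by
  by_contra! h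
  set e : ℝ := 1 / (4 * (|w| + 1)) with he
  have he0 : 0 < e := by positivity
  have hwe : |w| * e ≤ 1 / 4 := by
    rw [he, mul_one_div, div_le_div_iff₀ (by positivity) (by norm_num)]
    linarith [abs_nonneg w]
  have h1 : ∀ t, ∫ y, K y * (hatFun e (t - y i) : ℂ) = 0 := by
    intro t
    have := profile_second_difference K i α β e t
    rw [h, h, h] at this
    simpa [hα] using this.symm
  have h2 := integral_fourierChar_mul_conv_hatFun K i he0 w
  simp only [h1, mul_zero, integral_zero] at h2
  exact mul_ne_zero hK (integral_fourierChar_mul_hatFun_ne_zero he0 hwe) h2.symm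

/-- Rescaled convolutions of a function with a kink along `x_i = 0` are close to the profile. -/
lemma exists_norm_integral_sub_profile_le (K : 𝓢(𝔼, ℂ)) (i : Fin d) {h : 𝔼 → ℝ}
    (hh : Continuous h) (hhc : HasCompactSupport h) {α β C δ : ℝ} (hδ : 0 < δ)
    (hhC : ∀ x, |h x| ≤ C * |x i|) (hhδ : ∀ x, ‖x‖ < δ → h x = α * |x i| + β * x i) (R : ℝ) :
    ∃ D, ∀ (e : ℝ) (x : 𝔼), 0 < e → ‖x‖ < δ / 2 → |x i| ≤ R * e →
      ‖(∫ y, K y * (h (x - e • y) : ℂ)) - e * profile K i α β (x i / e)‖ ≤ D * e ^ 2 := by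
  set C' := |C| + (|α| + |β|)
  refine ⟨∫ y, C' * (2 / δ) * (|R| * (‖y‖ ^ 1 * ‖K y‖) + ‖y‖ ^ 2 * ‖K y‖),
    fun e x he hx hxR => ?_⟩
  have hi1 : Integrable fun y => K y * (h (x - e • y) : ℂ) := by
    obtain ⟨B, hB⟩ := hhc.exists_bound_of_continuous hh
    refine K.integrable.mul_bdd (c := B) ?_ (Filter.Eventually.of_forall fun y => ?_)
    · exact (Complex.continuous_ofReal.comp (hh.comp (by fun_prop))).aestronglyMeasurable
    · rw [Complex.norm_real]; exact hB _
  rw [profile, ← integral_const_mul, ← integral_sub hi1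
    ((integrable_profile K i α β _).const_mul _), mul_comm _ (e ^ 2), ← integral_const_mul]
  refine norm_integral_le_of_norm_le ?_ (Filter.Eventually.of_forall fun y => ?_)
  · exact ((((K.integrable_pow_mul volume 1).const_mul _).add
      (K.integrable_pow_mul volume 2)).const_mul _).const_mul _
  set t := x i / e with ht
  have hcoord : (x - e • y) i = e * (t - y i) := by
    simp only [PiLp.sub_apply, PiLp.smul_apply, smul_eq_mul, ht]
    field_simp
  have htR : |t| ≤ |R| := by
    rw [ht, abs_div, abs_of_pos he, div_le_iff₀ he]
    exact hxR.trans (by gcongr; exact le_abs_self R)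
  have hrew : K y * (h (x - e • y) : ℂ) - e * (K y * ((α * |t - y i| + β * (t - y i) : ℝ) : ℂ)) =
      K y * ((h (x - e • y) - e * (α * |t - y i| + β * (t - y i)) : ℝ) : ℂ) := by
    push_cast; ring
  rw [hrew, norm_mul, Complex.norm_real, Real.norm_eq_abs]
  -- For small `y` the argument stays where `h` is exactly the kink, and homogeneity makes the error
  -- zero. For large `y` both terms are only `O(e (|R| + ‖y‖))`, but `1 ≤ (2 / δ) e ‖y‖` supplies
  -- the second power of `e`, paid for by the decay of `K`.
  rcases lt_or_ge ‖y‖ (δ / (2 * e)) with hy | hy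
  · have hlt : ‖x - e • y‖ < δ := by
      have h1 : ‖e • y‖ < δ / 2 := by
        rw [norm_smul, Real.norm_of_nonneg he.le]
        calc e * ‖y‖ < e * (δ / (2 * e)) := by gcongr
          _ = δ / 2 := by field_simp
      linarith [norm_sub_le x (e • y)]
    rw [hhδ _ hlt, hcoord, abs_mul, abs_of_pos he]
    have : α * (e * |t - y i|) + β * (e * (t - y i)) - e * (α * |t - y i| + β * (t - y i)) = 0 := by
      ring
    rw [this, abs_zero, mul_zero]
    positivity
  · have h1 : |t - y i| ≤ |R| + ‖y‖ :=
      (abs_sub _ _).trans (add_le_add htR (abs_coord_le_norm y i))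
    have h2 : |h (x - e • y) - e * (α * |t - y i| + β * (t - y i))| ≤ C' * e * (|R| + ‖y‖) := by
      have h3 : |h (x - e • y)| ≤ |C| * (e * |t - y i|) := by
        refine (hhC _).trans ?_
        rw [hcoord, abs_mul, abs_of_pos he]
        gcongr
        exact le_abs_self C
      have h4 : |α * |t - y i| + β * (t - y i)| ≤ (|α| + |β|) * |t - y i| := by
        refine (abs_add_le _ _).trans ?_
        rw [abs_mul, abs_mul, abs_abs, ← add_mul]
      calc _ ≤ |h (x - e • y)| + |e * (α * |t - y i| + β * (t - y i))| := abs_sub _ _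
        _ ≤ |C| * (e * |t - y i|) + e * ((|α| + |β|) * |t - y i|) := by
            rw [abs_mul e, abs_of_pos he]; gcongr
        _ = C' * e * |t - y i| := by ring
        _ ≤ _ := by gcongr
    have h5 : 1 ≤ 2 / δ * e * ‖y‖ := by
      rw [div_le_iff₀ (by positivity)] at hy
      rw [div_mul_eq_mul_div, div_mul_eq_mul_div, le_div_iff₀ hδ]
      linarith
    calc ‖K y‖ * |h (x - e • y) - e * (α * |t - y i| + β * (t - y i))|
        ≤ ‖K y‖ * (C' * e * (|R| + ‖y‖)) := by gcongr
      _ = ‖K y‖ * (C' * e * (|R| + ‖y‖)) * 1 := (mul_one _).symm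
      _ ≤ ‖K y‖ * (C' * e * (|R| + ‖y‖)) * (2 / δ * e * ‖y‖) := by gcongr
      _ = _ := by ring

/-- Rescaled convolutions of a function with a kink along `x_i = 0` are bounded below by a
multiple of the scale on slabs at distance comparable to the scale from the kink. -/
lemma exists_le_norm_integral {K : 𝓢(𝔼, ℂ)} {i : Fin d} {w : ℝ}
    (hK : (𝓕 K) (EuclideanSpace.single i w) ≠ 0) {h : 𝔼 → ℝ}
    (hh : Continuous h) (hhc : HasCompactSupport h) {α β C δ : ℝ} (hα : α ≠ 0) (hδ : 0 < δ)
    (hhC : ∀ x, |h x| ≤ C * |x i|) (hhδ : ∀ x, ‖x‖ < δ → h x = α * |x i| + β * x i) :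
    ∃ t ρ c e₀ : ℝ, 0 < ρ ∧ 4 * ρ ≤ |t| ∧ 0 < c ∧ 0 < e₀ ∧
      ∀ (e : ℝ) (x : 𝔼), 0 < e → e ≤ e₀ → ‖x‖ < δ / 2 → |x i - e * t| < e * ρ →
        c * e ≤ ‖∫ y, K y * (h (x - e • y) : ℂ)‖ := by
  have hcont := continuous_profile K i α β
  -- The point is moved off `0` by continuity, so that slabs belonging to different scales can be
  -- separated.
  obtain ⟨t, ht0, ht⟩ : ∃ t, t ≠ 0 ∧ profile K i α β t ≠ 0 := by
    obtain ⟨t₁, ht₁⟩ := exists_profile_ne_zero hK hα β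
    have h1 : ∀ᶠ t in 𝓝 t₁, profile K i α β t ≠ 0 := hcont.continuousAt.eventually_ne ht₁
    have h2 := (dense_compl_singleton (0 : ℝ)).inter_nhds_nonempty h1
    obtain ⟨t, h3, h4⟩ := h2
    exact ⟨t, h3, h4⟩
  -- Near `t` the profile exceeds `2 * c`; for `e ≤ c / (|D| + 1)` the error `D * e ^ 2` costs at
  -- most `c * e`, and `c * e` survives.
  set c := ‖profile K i α β t‖ / 3 with hc
  have hc0 : 0 < c := by have := norm_pos_iff.2 ht; positivity
  have h1 : ∀ᶠ t' in 𝓝 t, 2 * c < ‖profile K i α β t'‖ := by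
    refine hcont.norm.continuousAt.eventually (lt_mem_nhds ?_)
    rw [hc]; linarith
  obtain ⟨ρ₁, hρ₁, hρ⟩ := Metric.eventually_nhds_iff.1 h1
  set ρ := min ρ₁ (|t| / 4)
  have htp : 0 < |t| := abs_pos.2 ht0
  have hρ0 : 0 < ρ := lt_min hρ₁ (by positivity)
  obtain ⟨D, hD⟩ := exists_norm_integral_sub_profile_le K i hh hhc hδ hhC hhδ (|t| + ρ)
  refine ⟨t, ρ, c, c / (|D| + 1), hρ0, ?_, hc0, by positivity, fun e x he hee hx hxt => ?_⟩
  · have := min_le_right ρ₁ (|t| / 4)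
    linarith
  have hx1 : |x i| ≤ (|t| + ρ) * e := by
    have := abs_add_le (x i - e * t) (e * t)
    rw [sub_add_cancel, abs_mul e, abs_of_pos he] at this
    linarith
  have h2 := hD e x he hx hx1
  have h3 : 2 * c < ‖profile K i α β (x i / e)‖ := by
    refine hρ ?_
    rw [Real.dist_eq]
    have : x i / e - t = (x i - e * t) / e := by field_simp
    rw [this, abs_div, abs_of_pos he, div_lt_iff₀ he, mul_comm ρ₁]
    exact hxt.trans_le (mul_le_mul_of_nonneg_left (min_le_left _ _) he.le)
  have h4 : D * e ^ 2 ≤ c * e := by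
    rw [le_div_iff₀ (by positivity)] at hee
    calc D * e ^ 2 ≤ (|D| + 1) * e ^ 2 := by gcongr; linarith [le_abs_self D]
      _ = e * (|D| + 1) * e := by ring
      _ ≤ c * e := by gcongr
  have h5 : ‖(e : ℂ) * profile K i α β (x i / e)‖ = e * ‖profile K i α β (x i / e)‖ := by
    rw [norm_mul, Complex.norm_real, Real.norm_of_nonneg he.le]
  have h6 := norm_sub_norm_le ((e : ℂ) * profile K i α β (x i / e))
    (∫ y, K y * (h (x - e • y) : ℂ))
  rw [norm_sub_rev, h5] at h6
  nlinarith

end Profile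

/-! ### Divergence of the Morrey norm for functions with a kink -/

section LowerBounds

variable {d : ℕ}

local notation "𝔼" => EuclideanSpace ℝ (Fin d)

/-- A single term suffices, and the shift from `k` to `k + 1` only increases the weight because `s ≥
0`. -/
lemma mul_rpow_le_weightedSeqNorm {s : ℝ} (hs : 0 ≤ s) {q : ℝ≥0∞} (hq : 1 ≤ q) {a : ℕ → ℝ≥0∞}
    {c : ℝ≥0∞} {k : ℕ} (h : c * (2 : ℝ≥0∞) ^ (-(k : ℝ)) ≤ a (k + 1)) :
    c * (2 : ℝ≥0∞) ^ ((k : ℝ) * (s - 1)) ≤ weightedSeqNorm s q a := by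
  refine le_trans ?_ (le_weightedSeqNorm hq a (k + 1))
  calc c * (2 : ℝ≥0∞) ^ ((k : ℝ) * (s - 1))
      = (2 : ℝ≥0∞) ^ ((k : ℝ) * s) * (c * (2 : ℝ≥0∞) ^ (-(k : ℝ))) := by
        rw [show (k : ℝ) * (s - 1) = k * s + -k by ring,
          ENNReal.rpow_add _ _ (by norm_num) (by norm_num)]
        ring
    _ ≤ (2 : ℝ≥0∞) ^ (((k + 1 : ℕ) : ℝ) * s) * a (k + 1) := by
        gcongr
        · norm_num
        · linarith

/-- If the pieces are large on balls of radius comparable to `2⁻ᵏ` then the Morrey norm is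
infinite for `s > 1 + d / u`. -/
lemma morreyNorm_eq_top_of_ball {s u p : ℝ} {q : ℝ≥0∞} (hp : 1 ≤ p) (hpu : p ≤ u) (hq : 1 ≤ q)
    (hs : 1 + (d : ℝ) / u < s) (hd : 0 < d) {A : ℕ → 𝔼 → ℝ≥0∞} {c : ℝ≥0∞} (hc : c ≠ 0)
    {ρ : ℝ} (hρ : 0 < ρ) {k₀ : ℕ} {y : ℕ → 𝔼}
    (hA : ∀ k ≥ k₀, ∀ x ∈ Metric.ball (y k) (((2 : ℝ) ^ k)⁻¹ * ρ),
      c * (2 : ℝ≥0∞) ^ (-(k : ℝ)) ≤ A (k + 1) x) :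
    morreyNorm u p (fun x => weightedSeqNorm s q (fun k => A k x)) = ⊤ := by
  have hp0 : 0 < p := by linarith
  have hu0 : 0 < u := by linarith
  have : Nontrivial 𝔼 := by
    have : Nonempty (Fin d) := ⟨⟨0, hd⟩⟩
    infer_instance
  have hdu : 0 ≤ (d : ℝ) / u := by positivity
  set W : 𝔼 → ℝ≥0∞ := fun x => weightedSeqNorm s q (fun k => A k x) with hW
  set V₁ := volume (Metric.ball (0 : 𝔼) ρ) with hV₁
  have hV₁0 : V₁ ≠ 0 := (Metric.measure_ball_pos volume _ hρ).ne'
  set κ : ℝ≥0∞ := c * V₁ ^ (1 / u) with hκ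
  have hκ0 : κ ≠ 0 := by
    refine mul_ne_zero hc ?_
    rw [Ne, ENNReal.rpow_eq_zero_iff_of_pos (by positivity)]
    exact hV₁0
  set γ := s - 1 - d / u with hγ
  have hγ0 : 0 < γ := by linarith
  have key : ∀ k ≥ k₀, κ * ((2 : ℝ≥0∞) ^ γ) ^ k ≤ morreyNorm u p W := by
    intro k hk
    refine le_trans ?_ (le_morreyNorm u p W (y k) (r := ((2 : ℝ) ^ k)⁻¹ * ρ) (by positivity))
    set V := volume (Metric.ball (y k) (((2 : ℝ) ^ k)⁻¹ * ρ)) with hV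
    have hVeq : V = (2 : ℝ≥0∞) ^ (-((k : ℝ) * d)) * V₁ := by
      rw [hV, Measure.addHaar_ball_mul volume (y k) (by positivity) ρ, hV₁]
      congr 1
      rw [finrank_euclideanSpace_fin, ENNReal.rpow_neg, ← Nat.cast_mul, ENNReal.rpow_natCast,
        inv_pow, ← pow_mul, ENNReal.ofReal_inv_of_pos (by positivity),
        ENNReal.ofReal_pow (by norm_num)]
      simp
    have hV0 : V ≠ 0 := (Metric.measure_ball_pos volume _ (by positivity)).ne'
    have hVt : V ≠ ⊤ := measure_ball_lt_top.ne
    set L := c * (2 : ℝ≥0∞) ^ ((k : ℝ) * (s - 1)) with hL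
    have h1 : L ^ p * V ≤ ∫⁻ x in Metric.ball (y k) (((2 : ℝ) ^ k)⁻¹ * ρ), W x ^ p := by
      rw [hV, ← setLIntegral_const]
      refine setLIntegral_mono' measurableSet_ball fun x hx => ?_
      exact ENNReal.rpow_le_rpow
        (mul_rpow_le_weightedSeqNorm (by linarith) hq (hA k hk x hx)) hp0.le
    -- The volume powers `1 / u - 1 / p` and `1 / p` combine to `1 / u`; as `V` scales like
    -- `2^{-kd}`, this leaves the growth rate `γ = s - 1 - d / u > 0`.
    calc κ * ((2 : ℝ≥0∞) ^ γ) ^ k = L * V ^ (1 / u) := by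
          rw [hVeq, ENNReal.mul_rpow_of_nonneg _ _ (by positivity), ← ENNReal.rpow_mul,
            ← ENNReal.rpow_mul_natCast, hκ, hL]
          have : γ * k = k * (s - 1) + -((k : ℝ) * d) * (1 / u) := by rw [hγ]; ring
          rw [this, ENNReal.rpow_add _ _ (by norm_num) (by norm_num)]
          ring
      _ = V ^ (1 / u - 1 / p) * (L ^ p * V) ^ (1 / p) := by
          rw [ENNReal.mul_rpow_of_nonneg _ _ (by positivity), ← ENNReal.rpow_mul,
            mul_one_div_cancel hp0.ne', ENNReal.rpow_one, mul_left_comm,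
            ← ENNReal.rpow_add _ _ hV0 hVt, sub_add_cancel]
      _ ≤ _ := by gcongr
  have hlim : Filter.Tendsto (fun k : ℕ => κ * ((2 : ℝ≥0∞) ^ γ) ^ k) Filter.atTop (𝓝 ⊤) := by
    have h2 : 1 < (2 : ℝ≥0∞) ^ γ := ENNReal.one_lt_rpow (by norm_num) hγ0
    have h3 := ENNReal.Tendsto.const_mul (a := κ)
      (ENNReal.tendsto_pow_atTop_nhds_top_iff.2 h2) (Or.inl ENNReal.top_ne_zero)
    rwa [ENNReal.mul_top hκ0] at h3
  refine top_le_iff.1 (le_of_tendsto hlim ?_)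
  filter_upwards [Filter.eventually_ge_atTop k₀] with k hk
  exact key k hk

/-- A product of one interval in the direction `i` and centred intervals in the others. -/
def slab (i : Fin d) (η a b : ℝ) : Set 𝔼 :=
  {x | x i ∈ Set.Ioo a b ∧ ∀ j ≠ i, x j ∈ Set.Ioo (-η) η}

lemma slab_eq_preimage (i : Fin d) (η a b : ℝ) : slab i η a b = WithLp.ofLp ⁻¹'
    (Set.univ.pi (Function.update (fun _ => Set.Ioo (-η) η) i (Set.Ioo a b))) := by
  ext x
  simp only [slab, Set.mem_ofPred_eq, Set.mem_preimage, Set.mem_pi, Set.mem_univ, true_implies]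
  constructor
  · rintro ⟨h1, h2⟩ j
    by_cases hj : j = i
    · subst hj; simpa using h1
    · simpa [Function.update_of_ne hj] using h2 j hj
  · intro h
    refine ⟨by simpa using h i, fun j hj => ?_⟩
    simpa [Function.update_of_ne hj] using h j

lemma measurableSet_pi_update (i : Fin d) (η a b : ℝ) : MeasurableSet
    (Set.univ.pi (Function.update (fun _ : Fin d => Set.Ioo (-η) η) i (Set.Ioo a b))) := by
  refine MeasurableSet.univ_pi fun j => ?_
  by_cases hj : j = i
  · subst hj; simp
  · simp [Function.update_of_ne hj]

lemma measurableSet_slab (i : Fin d) (η a b : ℝ) : MeasurableSet (slab i η a b) := by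
  rw [slab_eq_preimage]
  exact (PiLp.volume_preserving_ofLp (Fin d)).measurable (measurableSet_pi_update i η a b)

lemma volume_slab (i : Fin d) (η a b : ℝ) : volume (slab i η a b) =
    ENNReal.ofReal (b - a) * ENNReal.ofReal (2 * η) ^ (d - 1) := by
  rw [slab_eq_preimage, (PiLp.volume_preserving_ofLp (Fin d)).measure_preimage
    (measurableSet_pi_update i η a b).nullMeasurableSet, volume_pi_pi,
    ← Finset.mul_prod_erase _ _ (Finset.mem_univ i), Function.update_self, Real.volume_Ioo]
  congr 1
  rw [Finset.prod_congr rfl (g := fun _ => ENNReal.ofReal (2 * η)), Finset.prod_const,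
    Finset.card_erase_of_mem (Finset.mem_univ i), Finset.card_univ, Fintype.card_fin]
  intro j hj
  rw [Function.update_of_ne (Finset.ne_of_mem_erase hj), Real.volume_Ioo]
  congr 1; ring

/-- If the pieces are large on slabs of width comparable to `2⁻ᵏ` then the Morrey norm is
infinite for `s ≥ 1 + 1 / p`. -/
lemma morreyNorm_eq_top_of_slab {s u p : ℝ} {q : ℝ≥0∞} (hp : 1 ≤ p) (hq : 1 ≤ q)
    (hs : 1 + 1 / p ≤ s) {A : ℕ → 𝔼 → ℝ≥0∞} {c : ℝ≥0∞} (hc : c ≠ 0)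
    {ρ t η r : ℝ} (hρ : 0 < ρ) (hρt : 4 * ρ ≤ |t|) (hη : 0 < η) (hr : 0 < r) {k₀ : ℕ} {i : Fin d}
    (hsub : ∀ k ≥ k₀, slab i η (((2 : ℝ) ^ k)⁻¹ * (t - ρ)) (((2 : ℝ) ^ k)⁻¹ * (t + ρ)) ⊆
      Metric.ball 0 r)
    (hA : ∀ k ≥ k₀, ∀ x ∈ slab i η (((2 : ℝ) ^ k)⁻¹ * (t - ρ)) (((2 : ℝ) ^ k)⁻¹ * (t + ρ)),
      c * (2 : ℝ≥0∞) ^ (-(k : ℝ)) ≤ A (k + 1) x) :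
    morreyNorm u p (fun x => weightedSeqNorm s q (fun k => A k x)) = ⊤ := by
  have hp0 : 0 < p := by linarith
  have hs0 : 0 ≤ s := le_trans (by positivity) hs
  set W : 𝔼 → ℝ≥0∞ := fun x => weightedSeqNorm s q (fun k => A k x) with hW
  let S : ℕ → Set 𝔼 := fun k =>
    slab i η (((2 : ℝ) ^ (k + k₀))⁻¹ * (t - ρ)) (((2 : ℝ) ^ (k + k₀))⁻¹ * (t + ρ))
  have hSm : ∀ k, MeasurableSet (S k) := fun k => measurableSet_slab _ _ _ _
  -- Since `4 * ρ ≤ |t|`, `|x i|` lies within a factor between `3/4` and `5/4` of `2⁻ⁿ|t|`, where `n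
  -- = k + k₀`. Halving the scale gives at most `5/8 < 3/4`, so distinct slabs are disjoint.
  have habs : ∀ k, ∀ x ∈ S k, ((2 : ℝ) ^ (k + k₀))⁻¹ * (|t| * (3 / 4)) < |x i| ∧
      |x i| < ((2 : ℝ) ^ (k + k₀))⁻¹ * (|t| * (5 / 4)) := by
    rintro k x ⟨⟨h1, h2⟩, -⟩
    have he : 0 < ((2 : ℝ) ^ (k + k₀))⁻¹ := by positivity
    set e := ((2 : ℝ) ^ (k + k₀))⁻¹
    have h3 : |x i - e * t| < e * ρ := by
      rw [abs_lt]; constructor <;> linarith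
    have h4 : |e * t| = e * |t| := by rw [abs_mul, abs_of_pos he]
    have h5 := abs_sub_abs_le_abs_sub (x i) (e * t)
    have h6 := abs_sub_abs_le_abs_sub (e * t) (x i)
    rw [abs_sub_comm (e * t)] at h6
    have h7 : e * (4 * ρ) ≤ e * |t| := by gcongr
    constructor <;> linarith
  have hdisj' : ∀ k l, k < l → Disjoint (S k) (S l) := by
    intro k l hkl
    rw [Set.disjoint_left]
    intro x hxk hxl
    have h1 := (habs k x hxk).1
    have h2 := (habs l x hxl).2
    have h3 : ((2 : ℝ) ^ (l + k₀))⁻¹ ≤ ((2 : ℝ) ^ (k + k₀))⁻¹ * (1 / 2) := by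
      have : ((2 : ℝ) ^ (k + k₀))⁻¹ * (1 / 2) = ((2 : ℝ) ^ (k + k₀ + 1))⁻¹ := by
        rw [pow_succ, mul_inv]; norm_num
      rw [this]
      refine inv_anti₀ (by positivity) (pow_le_pow_right₀ (by norm_num) (by omega))
    have h4 : 0 < ((2 : ℝ) ^ (k + k₀))⁻¹ * |t| := by
      have : 0 < |t| := by linarith
      positivity
    have h5 : ((2 : ℝ) ^ (l + k₀))⁻¹ * (|t| * (5 / 4)) ≤
      ((2 : ℝ) ^ (k + k₀))⁻¹ * (1 / 2) * (|t| * (5 / 4)) := by gcongr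
    nlinarith
  have hdisj : Pairwise (Function.onFun Disjoint S) := by
    intro k l hkl
    rcases lt_or_gt_of_ne hkl with h | h
    · exact hdisj' k l h
    · exact (hdisj' l k h).symm
  set κ : ℝ≥0∞ := c ^ p * (ENNReal.ofReal (2 * ρ) * ENNReal.ofReal (2 * η) ^ (d - 1)) with hκ
  have hκ0 : κ ≠ 0 := by
    refine mul_ne_zero ?_ (mul_ne_zero ?_ (pow_ne_zero _ ?_))
    · rwa [Ne, ENNReal.rpow_eq_zero_iff_of_pos hp0]
    · rw [Ne, ENNReal.ofReal_eq_zero, not_le]; positivity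
    · rw [Ne, ENNReal.ofReal_eq_zero, not_le]; positivity
  -- The exponent `n((s - 1)p - 1)` is nonnegative, including at the endpoint `s = 1 + 1 / p`; a
  -- uniform lower bound `κ > 0` already makes the sum diverge.
  have hterm : ∀ k, κ ≤ ∫⁻ x in S k, W x ^ p := by
    intro k
    set n := k + k₀
    have hvol : volume (S k) = (2 : ℝ≥0∞) ^ (-(n : ℝ)) *
        (ENNReal.ofReal (2 * ρ) * ENNReal.ofReal (2 * η) ^ (d - 1)) := by
      rw [volume_slab, ← mul_assoc]
      congr 1
      rw [← mul_sub, show t + ρ - (t - ρ) = 2 * ρ by ring, ENNReal.ofReal_mul (by positivity),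
        ENNReal.rpow_neg, ENNReal.rpow_natCast, ENNReal.ofReal_inv_of_pos (by positivity),
        ENNReal.ofReal_pow (by norm_num)]
      simp [n]
    calc κ ≤ (2 : ℝ≥0∞) ^ ((n : ℝ) * (s - 1) * p + -(n : ℝ)) * κ := by
          refine le_mul_of_one_le_left' ?_
          have h1 : 1 ≤ (s - 1) * p := by
            have : 1 / p ≤ s - 1 := by linarith
            rwa [div_le_iff₀ hp0] at this
          have h2 : 0 ≤ (n : ℝ) * (s - 1) * p + -(n : ℝ) := by
            have := mul_le_mul_of_nonneg_left h1 (Nat.cast_nonneg (α := ℝ) n)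
            linarith
          have := ENNReal.rpow_le_rpow_of_exponent_le (x := 2) (by norm_num) h2
          simpa using this
      _ = (c * (2 : ℝ≥0∞) ^ ((n : ℝ) * (s - 1))) ^ p * volume (S k) := by
          rw [hvol, hκ, ENNReal.mul_rpow_of_nonneg _ _ hp0.le, ← ENNReal.rpow_mul,
            ENNReal.rpow_add _ _ (by norm_num) (by norm_num)]
          ring
      _ = ∫⁻ _ in S k, (c * (2 : ℝ≥0∞) ^ ((n : ℝ) * (s - 1))) ^ p := by
          rw [setLIntegral_const]
      _ ≤ ∫⁻ x in S k, W x ^ p := by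
          refine setLIntegral_mono' (hSm k) fun x hx => ?_
          exact ENNReal.rpow_le_rpow (mul_rpow_le_weightedSeqNorm hs0 hq
            (hA n (Nat.le_add_left _ _) x hx)) hp0.le
  have htop : ∫⁻ x in Metric.ball 0 r, W x ^ p = ⊤ := by
    rw [← top_le_iff]
    calc (⊤ : ℝ≥0∞) = ∑' _ : ℕ, κ := (ENNReal.tsum_const_eq_top_of_ne_zero hκ0).symm
      _ ≤ ∑' k, ∫⁻ x in S k, W x ^ p := ENNReal.tsum_le_tsum hterm
      _ = ∫⁻ x in ⋃ k, S k, W x ^ p := (lintegral_iUnion hSm hdisj _).symm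
      _ ≤ _ := lintegral_mono_set (Set.iUnion_subset fun k => hsub _ (Nat.le_add_left _ _))
  have h1 := le_morreyNorm u p W 0 hr
  rw [htop, ENNReal.top_rpow_of_pos (by positivity), ENNReal.mul_top] at h1
  · exact top_le_iff.1 h1
  · have hV0 : volume (Metric.ball (0 : 𝔼) r) ≠ 0 := (Metric.measure_ball_pos volume _ hr).ne'
    have hVt : volume (Metric.ball (0 : 𝔼) r) ≠ ⊤ := measure_ball_lt_top.ne
    exact (ENNReal.rpow_pos hV0.bot_lt hVt).ne'

lemma norm_lt_of_coord_le {η : ℝ} (hη : 0 < η) {x : 𝔼} (hx : ∀ j, |x j| ≤ η) :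
    ‖x‖ < η * (d + 1) := by
  refine lt_of_pow_lt_pow_left₀ 2 (by positivity) ?_
  rw [EuclideanSpace.norm_sq_eq]
  calc ∑ j, ‖x j‖ ^ 2 ≤ ∑ _ : Fin d, η ^ 2 := by
        gcongr with j
        exact hx j
    _ = d * η ^ 2 := by simp
    _ < (η * (d + 1)) ^ 2 := by
        have : 0 ≤ (d : ℝ) := Nat.cast_nonneg d
        have h2 : 0 < η ^ 2 := by positivity
        nlinarith

/-- Compactly supported functions with a kink along a hyperplane do not belong to
Triebel–Lizorkin–Morrey spaces of high smoothness. -/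
lemma notMem_triebelLizorkinMorrey {φ₀ : 𝔼 → ℝ} (hφ : IsDyadicGenerator φ₀) {s u p : ℝ}
    {q : ℝ≥0∞} (hp : 1 ≤ p) (hpu : p ≤ u) (hq : 1 ≤ q)
    (hs : 1 + 1 / p ≤ s ∨ 1 + (d : ℝ) / u < s) (i : Fin d) {h : 𝔼 → ℝ}
    (hh : Continuous h) (hhc : HasCompactSupport h) {α β C δ : ℝ} (hα : α ≠ 0) (hδ : 0 < δ)
    (hhC : ∀ x, |h x| ≤ C * |x i|) (hhδ : ∀ x, ‖x‖ < δ → h x = α * |x i| + β * x i) :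
    h ∉ triebelLizorkinMorrey φ₀ s u p q := by
  rintro ⟨T, g, hT, hg, hfin⟩
  have hd : 0 < d := i.pos
  -- At distance `3/2` one has `φ₁ = φ₀(ξ/2) - φ₀(ξ) = 1 - 0` for every admissible `φ₀`.
  have hK : (𝓕 hφ.kernel) (EuclideanSpace.single i (3 / 2)) ≠ 0 := by
    rw [IsDyadicGenerator.kernel, FourierTransform.fourier_fourierInv_eq]
    change ((dyadicPiece φ₀ 1 (EuclideanSpace.single i (3 / 2)) : ℝ) : ℂ) ≠ 0
    have : dyadicPiece φ₀ 1 (EuclideanSpace.single i (3 / 2)) = 1 := by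
      simp only [dyadicPiece, one_ne_zero, if_false]
      rw [hφ.eq_one, hφ.eq_zero, sub_zero]
      · simp
      · rw [norm_smul]; norm_num
    rw [this]; simp
  obtain ⟨t, ρ, c, e₀, hρ, hρt, hc, he₀, hlow⟩ :=
    exists_le_norm_integral hK hh hhc hα hδ hhC hhδ
  set A : ℕ → 𝔼 → ℝ≥0∞ := fun k x => ‖g k x‖ₑ with hAdef
  -- Coordinates bounded by `η` force `‖x‖ < δ / 4`, which keeps the slabs well inside the region
  -- where the kink formula holds.
  set η := δ / (4 * (d + 1)) with hη
  have hη0 : 0 < η := by positivity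
  obtain ⟨k₀, hk₀⟩ : ∃ k₀ : ℕ, ∀ k ≥ k₀, ((2 : ℝ) ^ k)⁻¹ ≤ e₀ ∧
      ((2 : ℝ) ^ k)⁻¹ * (|t| + ρ) ≤ η := by
    have h1 : Filter.Tendsto (fun k : ℕ => ((2 : ℝ) ^ k)⁻¹) Filter.atTop (𝓝 0) :=
      (tendsto_pow_atTop_atTop_of_one_lt (by norm_num)).inv_tendsto_atTop
    have h2 := h1.mul_const (|t| + ρ)
    rw [zero_mul] at h2
    exact Filter.eventually_atTop.1
      ((h1.eventually (ge_mem_nhds he₀)).and (h2.eventually (ge_mem_nhds hη0)))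
  have hA : ∀ k ≥ k₀, ∀ x : 𝔼, ‖x‖ < δ / 2 →
      |x i - ((2 : ℝ) ^ k)⁻¹ * t| < ((2 : ℝ) ^ k)⁻¹ * ρ →
      ENNReal.ofReal c * (2 : ℝ≥0∞) ^ (-(k : ℝ)) ≤ A (k + 1) x := by
    intro k hk x hx hxt
    have h1 := hlow ((2 : ℝ) ^ k)⁻¹ x (by positivity) (hk₀ k hk).1 hx hxt
    rw [← hφ.eq_integral_kernel hh hhc hT (hg (k + 1)) x] at h1
    rw [hAdef]
    simp only
    rw [← ofReal_norm]
    refine le_trans (le_of_eq ?_) (ENNReal.ofReal_le_ofReal h1)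
    rw [ENNReal.ofReal_mul hc.le, ENNReal.rpow_neg, ENNReal.rpow_natCast,
      ENNReal.ofReal_inv_of_pos (by positivity), ENNReal.ofReal_pow (by norm_num)]
    simp
  have hc' : ENNReal.ofReal c ≠ 0 := by
    rw [Ne, ENNReal.ofReal_eq_zero, not_le]; exact hc
  have hηδ : η * (d + 1) = δ / 4 := by rw [hη]; field_simp
  refine hfin.ne ?_
  rcases hs with hs | hs
  · have hsub : ∀ k ≥ k₀, slab i η (((2 : ℝ) ^ k)⁻¹ * (t - ρ)) (((2 : ℝ) ^ k)⁻¹ * (t + ρ)) ⊆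
        Metric.ball 0 (δ / 2) := by
      rintro k hk x ⟨⟨h1, h2⟩, h3⟩
      rw [mem_ball_zero_iff]
      refine (norm_lt_of_coord_le hη0 fun j => ?_).trans (by linarith)
      by_cases hj : j = i
      · subst hj
        refine le_trans ?_ (hk₀ k hk).2
        have he : 0 < ((2 : ℝ) ^ k)⁻¹ := by positivity
        have h4 : ((2 : ℝ) ^ k)⁻¹ * t ≤ ((2 : ℝ) ^ k)⁻¹ * |t| := by gcongr; exact le_abs_self t
        have h5 : ((2 : ℝ) ^ k)⁻¹ * -t ≤ ((2 : ℝ) ^ k)⁻¹ * |t| := by gcongr; exact neg_le_abs t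
        rw [abs_le]; constructor <;> linarith
      · exact abs_le.2 ⟨(h3 j hj).1.le, (h3 j hj).2.le⟩
    refine morreyNorm_eq_top_of_slab hp hq hs hc' hρ hρt hη0 (half_pos hδ) hsub
      fun k hk x hx => hA k hk x (mem_ball_zero_iff.1 (hsub k hk hx)) ?_
    obtain ⟨⟨h1, h2⟩, -⟩ := hx
    rw [abs_lt]; constructor <;> linarith
  · refine morreyNorm_eq_top_of_ball hp hpu hq hs hd hc' hρ (k₀ := k₀)
      (y := fun k => EuclideanSpace.single i (((2 : ℝ) ^ k)⁻¹ * t)) fun k hk x hx => ?_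
    rw [mem_ball_iff_norm] at hx
    refine hA k hk x ?_ ?_
    · have h1 : ‖EuclideanSpace.single i (((2 : ℝ) ^ k)⁻¹ * t)‖ = ((2 : ℝ) ^ k)⁻¹ * |t| := by
        rw [PiLp.norm_single, Real.norm_eq_abs, abs_mul, abs_of_pos (by positivity)]
      have h2 := norm_le_norm_add_norm_sub' x (EuclideanSpace.single i (((2 : ℝ) ^ k)⁻¹ * t))
      rw [h1] at h2
      have h3 := (hk₀ k hk).2
      have h4 : η ≤ δ / 4 := by
        rw [← hηδ]
        have : 0 ≤ η * d := by positivity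
        linarith
      linarith
    · refine lt_of_le_of_lt ?_ hx
      have := abs_coord_le_norm (x - EuclideanSpace.single i (((2 : ℝ) ^ k)⁻¹ * t)) i
      simpa using this

end LowerBounds

end

end MorreyTruncation

/-! ### The witness: a truncated coordinate function -/

theorem mainTheorem6 (d : ℕ) (hd : 0 < d) (p u s : ℝ) (q : ℝ≥0∞)
    (hp : 1 ≤ p) (hpu : p ≤ u) (hq : 1 ≤ q)
    (hs : 1 + 1 / p ≤ s ∨ 1 + (d : ℝ) / u < s) :
    ∃ f : EuclideanSpace ℝ (Fin d) → ℝ,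
      ContDiff ℝ ∞ f ∧ HasCompactSupport f ∧ (∀ᶠ x in 𝓝 0, f x = x ⟨0, hd⟩) ∧
      ∀ φ₀ : EuclideanSpace ℝ (Fin d) → ℝ, MorreyTruncation.IsDyadicGenerator φ₀ →
        f ∈ MorreyTruncation.triebelLizorkinMorrey φ₀ s u p q ∧
        (fun x => |f x|) ∉ MorreyTruncation.triebelLizorkinMorrey φ₀ s u p q ∧
        (fun x => max (f x) 0) ∉ MorreyTruncation.triebelLizorkinMorrey φ₀ s u p q := by
  let i : Fin d := ⟨0, hd⟩
  let b : ContDiffBump (0 : EuclideanSpace ℝ (Fin d)) := ⟨1, 2, by norm_num, by norm_num⟩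
  -- Cutting off by multiplication keeps the global bound `|f x| ≤ |x i|`, which the kink estimate
  -- needs away from the origin.
  let f : EuclideanSpace ℝ (Fin d) → ℝ := fun x => x i * b x
  have hf : ContDiff ℝ ∞ f :=
    ((EuclideanSpace.proj i : EuclideanSpace ℝ (Fin d) →L[ℝ] ℝ).contDiff).mul b.contDiff
  have hfc : HasCompactSupport f := b.hasCompactSupport.mul_left
  have hnear : ∀ x : EuclideanSpace ℝ (Fin d), ‖x‖ < 1 → f x = x i := fun x hx => by
    have : b x = 1 := b.one_of_mem_closedBall (by simpa using hx.le)
    simp [f, this]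
  have hle : ∀ x, |f x| ≤ 1 * |x i| := fun x => by
    rw [abs_mul, abs_of_nonneg b.nonneg, mul_comm]
    exact mul_le_mul_of_nonneg_right b.le_one (abs_nonneg _)
  refine ⟨f, hf, hfc, ?_, fun φ₀ hφ => ⟨?_, ?_, ?_⟩⟩
  · filter_upwards [Metric.ball_mem_nhds (0 : EuclideanSpace ℝ (Fin d)) one_pos] with x hx
    exact hnear x (mem_ball_zero_iff.1 hx)
  · exact MorreyTruncation.mem_triebelLizorkinMorrey_of_contDiff hφ hp hpu s hq hf hfc
  · refine MorreyTruncation.notMem_triebelLizorkinMorrey hφ hp hpu hq hs i hf.continuous.abs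
      (hfc.comp_left abs_zero) (α := 1) (β := 0) (C := 1) one_ne_zero one_pos
      (fun x => by simpa using hle x) fun x hx => ?_
    rw [hnear x hx]; ring
  -- The coefficients come from `max(t, 0) = (|t| + t) / 2`.
  · refine MorreyTruncation.notMem_triebelLizorkinMorrey hφ hp hpu hq hs i
      (hf.continuous.max continuous_const) (hfc.comp_left (g := fun r => max r 0) (max_self 0))
      (α := 1 / 2) (β := 1 / 2) (C := 1) (by norm_num) one_pos (fun x => ?_) fun x hx => ?_
    · refine le_trans ?_ (hle x)
      rw [abs_of_nonneg (le_max_right _ _)]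
      exact max_le (le_abs_self _) (abs_nonneg _)
    · rw [hnear x hx]
      rcases le_total 0 (x i) with h | h
      · rw [max_eq_left h, abs_of_nonneg h]; ring
      · rw [max_eq_right h, abs_of_nonpos h]; ring
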